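/- **Setting.** Let $E\subset\mathbb{R}^2$ be a closed strictly convex $n$-gon with vertices $x_1,\dots,x_n$ in counter-clockwise order, edge midpoints $\hat x_i=\frac12(x_i+x_{i+1})$ (indices mod $n$) and outward unit normal $\boldsymbol n$. Let $\mathcal P_m$ denote the polynomials of degree at most $m$ in two variables. Let $\varphi_1,\dots,\varphi_n$ be generalized barycentric coordinates on $E$: non-negative functions with $\sum_i\varphi_i=1$ and $\sum_i x_i\varphi_i(x)=x$ on $E$, continuous on $E$, locally Lipschitz in the interior, with gradients in $L^2(E)$. The quadratic (serendipity) element space is $\mathcal V_2(E)=\mathrm{span}\{\psi_1,\dots,\psi_{2n}\}$ with $\psi_i=\sum_{a,b=1}^n c_i^{ab}\varphi_a\varphi_b$, where the real coefficients $c_i^{ab}$ are such that $p=\sum_{i=1}^n\big[p(x_i)\psi_i+p(\hat x_i)\psi_{i+n}\big]$ on $E$ for all $p\in\mathcal P_2$, and the $\psi_i$ have the Kronecker delta property at the $2n$ nodes $x_1,\dots,x_n,\hat x_1,\dots,\hat x_n$. Let $\mathcal Q_E[g]=\sum_q w_q\,g(y_q)$ be a quadrature rule with finitely many points $y_q\in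 E$ and real weights $w_q$. For a constant symmetric positive definite $2\times2$ matrix $\mathbb K$ put $a^E(u,v)=\int_E\nabla u\cdot\mathbb K\nabla v\,dx$. A modified projection is a linear map $\Pi_2^E:\mathcal V_2(E)\to\mathcal P_2$ such that for all $p\in\mathcal P_2$ and $v\in\mathcal V_2(E)$ $$a^E(p,\Pi_2^Ev)=-\mathcal Q_E\big[v\,\mathrm{div}(\mathbb K\nabla p)\big]+\int_{\partial E}v\,\mathbb K\nabla p\cdot\boldsymbol n\,ds,\qquad \Pi_2^Ep=p,$$ and the corresponding discrete form is $$a_h^E(u,v)=a^E(\Pi_2^Eu,\Pi_2^Ev)+\mathcal Q_E\big[\nabla(u-\Pi_2^Eu)\cdot\mathbb K\nabla(v-\Pi_2^Ev)\big].$$ Write $|v|_{1,2,E}=|v|_{1,E}=\big(\int_E|\nabla v|^2dx\big)^{1/2}$. **Theorem.** For all real $\gamma,M,W$ and every natural number $N$ there is a constant $C>0$, depending only on $\gamma,M,W,N$, such that the following holds for every element $E$ as above, every choice of $\varphi_i$, $c_i^{ab}$ and quadrature as above, and every $h\ge\operatorname{diam}E$, provided that $n\le N$, the aspect ratio of $E$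 (diameter over inradius) is at most $\gamma$, $|c_i^{ab}|\le M$ for all $i,a,b$, $\sum_q|w_q|\le W|E|$, and the quadrature is exact on constants. 1. For all $v\in\mathcal V_2(E)$, $$\Big|\int_Ev\,dx-\mathcal Q_E[v]\Big|\le C\,h^2\,|v|_{1,2,E}.$$ 2. For every symmetric positive definite $\mathbb K$: if the quadrature is exact on $\mathcal P_2$, then a modified projection exists. For every modified projection, every $p\in\mathcal P_2$ and every $v\in\mathcal V_2(E)$, the function $c=\mathrm{div}(\mathbb K\nabla p)$ is constant on $E$ and $$\big|a_h^E(p,v)-a^E(p,v)\big|=|c|\,\Big|\int_Ev\,dx-\mathcal Q_E[v]\Big|\le C\,|c|\,h^2\,|v|_{1,2,E}.$$ In particular, the $O(h^m)$ consistency condition holds for $m=2$: the consistency error is at most a constant independent of $h$, $E$ and $v$ (for given $p$ and $\mathbb K$) times $h^2|v|_{1,E}$. -/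

import Mathlib

open MeasureTheory Matrix Set

noncomputable section

namespace PolyFE

/-- The Euclidean plane. -/
abbrev Plane : Type := EuclideanSpace ℝ (Fin 2)

/-- The planar cross product `a × b`. -/
def cross (a b : Plane) : ℝ := a 0 * b 1 - a 1 * b 0

/-- `P_m`: the real polynomial functions of total degree at most `m` in two variables. -/
def polyFun (m : ℕ) : Submodule ℝ (Plane → ℝ) :=
  (MvPolynomial.restrictTotalDegree (Fin 2) ℝ m).map
    (LinearMap.pi fun x : Plane => (MvPolynomial.aeval (R := ℝ) x.ofLp).toLinearMap)

theorem mem_polyFun {m : ℕ} {p : Plane → ℝ} :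
    p ∈ polyFun m ↔ ∃ q : MvPolynomial (Fin 2) ℝ, q.totalDegree ≤ m ∧
      ∀ x : Plane, p x = MvPolynomial.eval x.ofLp q := by
  simp only [polyFun, Submodule.mem_map, MvPolynomial.mem_restrictTotalDegree]
  constructor
  · rintro ⟨q, hq, rfl⟩
    exact ⟨q, hq, fun x => by simp [MvPolynomial.aeval_eq_eval]⟩
  · rintro ⟨q, hq, h⟩
    exact ⟨q, hq, funext fun x => by simp [h x, MvPolynomial.aeval_eq_eval]⟩

/-! ### Differential operators and forms on a closed region `S`

Derivatives are taken within `S`, so that they depend only on the values on `S`. -/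

/-- The flux field `K ∇u`. -/
def flux (S : Set Plane) (K : Matrix (Fin 2) (Fin 2) ℝ) (u : Plane → ℝ) (x : Plane) :
    Fin 2 → ℝ :=
  K *ᵥ (gradientWithin u S x).ofLp

/-- The divergence of a vector field on `S`. -/
def divergence (S : Set Plane) (F : Plane → Fin 2 → ℝ) (x : Plane) : ℝ :=
  ∑ i : Fin 2, fderivWithin ℝ (fun y => F y i) S x (EuclideanSpace.single i 1)

/-- The integrand `∇u · K ∇v`. -/
def energyDensity (S : Set Plane) (K : Matrix (Fin 2) (Fin 2) ℝ) (u v : Plane → ℝ)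
    (x : Plane) : ℝ :=
  (gradientWithin u S x).ofLp ⬝ᵥ flux S K v x

/-- The exact local form `a^S(u, v) = ∫_S ∇u · K ∇v`. -/
def energy (S : Set Plane) (K : Matrix (Fin 2) (Fin 2) ℝ) (u v : Plane → ℝ) : ℝ :=
  ∫ x in S, energyDensity S K u v x

/-- The seminorm `|v|_{1,S}` of `H¹(S)`. -/
def seminormH1 (S : Set Plane) (v : Plane → ℝ) : ℝ :=
  Real.sqrt (∫ x in S, ‖gradientWithin v S x‖ ^ 2)

/-- The aspect ratio of `S`, diameter over inradius, is at most `γ`. -/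
def AspectRatioLE (S : Set Plane) (γ : ℝ) : Prop :=
  ∃ (z : Plane) (r : ℝ), 0 < r ∧ Metric.closedBall z r ⊆ S ∧ Metric.diam S ≤ γ * r

/-! ### Quadrature -/

/-- A quadrature rule on `S`: finitely many points of `S` with real weights. -/
structure QuadratureRule (S : Set Plane) where
  size : ℕ
  point : Fin size → Plane
  weight : Fin size → ℝ
  point_mem : ∀ q, point q ∈ S

/-- The value of the quadrature rule on an integrand. -/
def QuadratureRule.apply {S : Set Plane} (Q : QuadratureRule S) (g : Plane → ℝ) : ℝ :=
  ∑ q, Q.weight q * g (Q.point q)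

/-- The rule is exact for polynomials of degree at most `m`. -/
def QuadratureRule.ExactOn {S : Set Plane} (Q : QuadratureRule S) (m : ℕ) : Prop :=
  ∀ g ∈ polyFun m, Q.apply g = ∫ x in S, g x

/-! ### Polygons and generalized barycentric coordinates -/

/-- A strictly convex `n`-gon with vertices in counter-clockwise order: every other vertex lies
strictly to the left of each directed edge. (`finRotate n` is the cyclic successor.) -/
structure ConvexPolygon (n : ℕ) where
  vert : Fin n → Plane
  three_le : 3 ≤ n
  ccw : ∀ i j, j ≠ i → j ≠ finRotate n i →
    0 < cross (vert (finRotate n i) - vert i) (vert j - vert i)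

namespace ConvexPolygon

variable {n : ℕ}

/-- The closed polygonal region. -/
def region (T : ConvexPolygon n) : Set Plane := convexHull ℝ (range T.vert)

/-- The `2n` nodes: the vertices and the midpoints of the edges. -/
def node (T : ConvexPolygon n) : Fin n ⊕ Fin n → Plane :=
  Sum.elim T.vert fun i => midpoint ℝ (T.vert i) (T.vert (finRotate n i))

/-- The outward normal of the `i`-th edge, scaled by the length of that edge. -/
def edgeNormal (T : ConvexPolygon n) (i : Fin n) : Fin 2 → ℝ :=
  ![T.vert (finRotate n i) 1 - T.vert i 1, -(T.vert (finRotate n i) 0 - T.vert i 0)]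

/-- The boundary integral `∫_{∂E} v F · n ds`, each edge being parametrized over `[0, 1]`. -/
def boundaryIntegral (T : ConvexPolygon n) (v : Plane → ℝ) (F : Plane → Fin 2 → ℝ) : ℝ :=
  ∑ i, ∫ t in (0 : ℝ)..1,
    v (AffineMap.lineMap (T.vert i) (T.vert (finRotate n i)) t) *
      (F (AffineMap.lineMap (T.vert i) (T.vert (finRotate n i)) t) ⬝ᵥ T.edgeNormal i)

/-- Generalized barycentric coordinates on the polygon: non-negative and linearly complete
functions that are continuous on the closed polygon and belong to `H¹`. Local Lipschitz
continuity in the interior makes the pointwise gradient, which exists almost everywhere, the weak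
gradient; it is a minimal regularity shared by smooth and piecewise smooth coordinates. -/
structure IsBarycentric (T : ConvexPolygon n) (φ : Fin n → Plane → ℝ) : Prop where
  nonneg : ∀ i, ∀ x ∈ T.region, 0 ≤ φ i x
  sum_one : ∀ x ∈ T.region, ∑ i, φ i x = 1
  linear : ∀ x ∈ T.region, ∑ i, φ i x • T.vert i = x
  continuousOn : ∀ i, ContinuousOn (φ i) T.region
  locallyLipschitz : ∀ i, LocallyLipschitzOn (interior T.region) (φ i)
  memLp_gradient : ∀ i, MemLp (gradientWithin (φ i) T.region) 2 (volume.restrict T.region)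

end ConvexPolygon

/-! ### The quadratic serendipity element -/

/-- The shape functions `ψ_i = ∑_{a,b} c_i^{ab} φ_a φ_b`. -/
def shapeFun {n : ℕ} (φ : Fin n → Plane → ℝ) (coef : Fin n ⊕ Fin n → Fin n → Fin n → ℝ)
    (i : Fin n ⊕ Fin n) (x : Plane) : ℝ :=
  ∑ a, ∑ b, coef i a b * φ a x * φ b x

/-- A quadratic serendipity element on a strictly convex `n`-gon: its `2n` shape functions are
combinations of pairwise products of generalized barycentric coordinates, reproduce quadratic
polynomials, and have the Kronecker delta property at vertices and edge midpoints. -/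
structure QuadraticElement (n : ℕ) extends ConvexPolygon n where
  bary : Fin n → Plane → ℝ
  coef : Fin n ⊕ Fin n → Fin n → Fin n → ℝ
  isBarycentric : toConvexPolygon.IsBarycentric bary
  precision : ∀ p ∈ polyFun 2, ∀ x ∈ toConvexPolygon.region,
    p x = ∑ i, p (toConvexPolygon.node i) * shapeFun bary coef i x
  kronecker : ∀ i j, shapeFun bary coef i (toConvexPolygon.node j) = if i = j then 1 else 0

namespace QuadraticElement

variable {n : ℕ}

/-- The element space `V_2(E)`: functions which on `E` are linear combinations of the shape
functions (values off `E` play no role). -/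
def space (E : QuadraticElement n) : Submodule ℝ (Plane → ℝ) where
  carrier := {v | ∃ d : Fin n ⊕ Fin n → ℝ,
    ∀ x ∈ E.region, v x = ∑ i, d i * shapeFun E.bary E.coef i x}
  add_mem' := by
    rintro u v ⟨d, hd⟩ ⟨e, he⟩
    exact ⟨d + e, fun x hx => by
      simp [hd x hx, he x hx, add_mul, Finset.sum_add_distrib]⟩
  zero_mem' := ⟨0, fun x _ => by simp⟩
  smul_mem' := by
    rintro r v ⟨d, hd⟩
    exact ⟨r • d, fun x hx => by simp [hd x hx, Finset.mul_sum, mul_assoc, mul_add]⟩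

theorem polyFun_le_space (E : QuadraticElement n) : polyFun 2 ≤ E.space :=
  fun p hp => ⟨fun i => p (E.node i), fun x hx => E.precision p hp x hx⟩

/-- `P` is the modified projection `V_2(E) → P_2(E)`: for all quadratic `p`, the value
`a^E(p, P v)` is `-⨍_E v div(K∇p) + ∫_{∂E} v K∇p · n`, where `⨍` is the quadrature, and `P` fixes
the quadratic polynomials on `E`. -/
structure IsModifiedProjection (E : QuadraticElement n) (K : Matrix (Fin 2) (Fin 2) ℝ)
    (Q : QuadratureRule E.region) (P : E.space →ₗ[ℝ] polyFun 2) : Prop where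
  energy_eq : ∀ p ∈ polyFun 2, ∀ v : E.space,
    energy E.region K p (P v : Plane → ℝ) =
      -Q.apply (fun x => (v : Plane → ℝ) x * divergence E.region (flux E.region K p) x) +
        E.boundaryIntegral v (flux E.region K p)
  fixes : ∀ (p : polyFun 2) (v : E.space),
    EqOn (v : Plane → ℝ) (p : Plane → ℝ) E.region → P v = p

/-- The discrete local form
`a_h^E(u, v) = a^E(P u, P v) + ⨍_E ∇(u - P u) · K ∇(v - P v)`. -/
def discreteEnergy (E : QuadraticElement n) (K : Matrix (Fin 2) (Fin 2) ℝ)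
    (Q : QuadratureRule E.region) (P : E.space →ₗ[ℝ] polyFun 2) (u v : E.space) : ℝ :=
  energy E.region K (P u : Plane → ℝ) (P v : Plane → ℝ) +
    Q.apply (energyDensity E.region K
      ((u : Plane → ℝ) - (P u : Plane → ℝ)) ((v : Plane → ℝ) - (P v : Plane → ℝ)))

end QuadraticElement

end PolyFE

end

/-!
The quadrature error of a function `v` of the element space is bounded by subtracting a nodal value
of `v`, which the quadrature integrates exactly: what remains is at most the area of `E` times the
oscillation of `v`, and the area is at most `π h²`. So the point is the inverse estimate
`osc v ≤ C |v|_{1,E}`, for barycentric coordinates about whose gradients nothing quantitative is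
known. It holds because `v` is determined by its trace. By the Kronecker property and the bound on
the coefficients, the oscillation of `v` is controlled by the differences of its nodal values, hence
by its increments along the edges. On each edge the barycentric coordinates are linear
(`ConvexPolygon.IsBarycentric.eq_on_edge`), so `v` is quadratic there, and its increments are two
linear functionals of the trace, combinations of integrals `∫ v ∂_τ s` over the edge. If the stream
function `s` is extended to a triangle over the edge so as to vanish on the other two sides, the
divergence theorem turns such an integral into `∫ ∇v · ∇^⊥ s`, which is at most a multiple of
`|v|_{1,E}` (`H1Regular.increment_le_of_quadratic`). The bound is invariant under similarities, so
short edges do no harm: the aspect ratio of `E` provides every edge with a triangle of bounded shape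
in `E` (`ConvexPolygon.exists_apex`).

The consistency error is `div (K∇p) (∫ v - ⨍ v)`, because the projection fixes `p`, the
stabilizing term vanishes, and Green's formula holds for `p` and `v` with exact integrals
(`ConvexPolygon.energy_eq`, `QuadraticElement.discreteEnergy_sub_energy`). The projection exists
by representing a functional in the inner product `a(p, q) + p(y) q(y)` on quadratics.

Both parts rest on the divergence theorem for functions that are merely continuous on `E`, locally
Lipschitz inside, with square integrable gradient (`H1Regular`). It is proved for Lipschitz
functions on a triangle by integration along lines and Rademacher's theorem, extended to a triangle touching
the boundary by contracting it towards a vertex in the interior, and summed over the triangles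
spanned by an interior point and the edges of `E`
(`ConvexPolygon.integral_inner_gradientWithin`).
-/

noncomputable section

namespace PolyFE

/-! ### Calculus on a triangle -/

theorem cross_smul_add (P R : Plane) (α β : ℝ) :
    cross (α • P + β • R) R = α * cross P R ∧ cross P (α • P + β • R) = β * cross P R := by
  simp only [cross, PiLp.add_apply, PiLp.smul_apply, smul_eq_mul]
  constructor <;> ring

/-- The standard half-open triangle in the parameter plane. -/
def refTriangle : Set (ℝ × ℝ) := {q | 0 < q.1 ∧ 0 ≤ q.2 ∧ q.1 + q.2 < 1}

theorem measurableSet_refTriangle : MeasurableSet refTriangle := by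
  unfold refTriangle
  refine (measurableSet_lt measurable_const measurable_fst).inter
    ((measurableSet_le measurable_const measurable_snd).inter
      (measurableSet_lt (measurable_fst.add measurable_snd) measurable_const))

theorem refTriangle_subset : refTriangle ⊆ Icc 0 1 ×ˢ Icc 0 1 := by
  rintro ⟨a, b⟩ ⟨h1, h2, h3⟩
  simp only [mem_prod, mem_Icc] at *
  refine ⟨⟨by linarith, by linarith⟩, by linarith, by linarith⟩

theorem volume_refTriangle_le : volume refTriangle ≤ 1 := by
  refine (measure_mono refTriangle_subset).trans ?_
  rw [Measure.volume_eq_prod, Measure.prod_prod]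
  simp

theorem integrableOn_lineDeriv {u : ℝ × ℝ → ℝ} {K : NNReal} (hu : LipschitzWith K u) (v : ℝ × ℝ) :
    IntegrableOn (fun q => lineDeriv ℝ u q v) refTriangle := by
  refine Measure.integrableOn_of_bounded (M := K * ‖v‖)
    (volume_refTriangle_le.trans_lt ENNReal.one_lt_top).ne
    (measurable_lineDeriv hu.continuous).aestronglyMeasurable ?_
  exact Filter.Eventually.of_forall fun q => norm_lineDeriv_le_of_lipschitz ℝ hu

theorem lineDeriv_fst (u : ℝ × ℝ → ℝ) (a b : ℝ) :
    lineDeriv ℝ u (a, b) (1, 0) = deriv (fun s => u (s, b)) a := by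
  have := deriv_comp_const_add (fun s => u (s, b)) a 0
  simp only [add_zero] at this
  rw [lineDeriv, ← this]
  simp

theorem lineDeriv_snd (u : ℝ × ℝ → ℝ) (a b : ℝ) :
    lineDeriv ℝ u (a, b) (0, 1) = deriv (fun s => u (a, s)) b := by
  have := deriv_comp_const_add (fun s => u (a, s)) b 0
  simp only [add_zero] at this
  rw [lineDeriv, ← this]
  simp

theorem integral_deriv_of_lipschitz {u : ℝ → ℝ} {K : NNReal} (hu : LipschitzWith K u) (a b : ℝ) :
    ∫ x in a..b, deriv u x = u b - u a :=
  (hu.lipschitzOnWith.absolutelyContinuousOnInterval).integral_deriv_eq_sub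

theorem integral_refTriangle_fst {u : ℝ × ℝ → ℝ} {K : NNReal} (hu : LipschitzWith K u) :
    ∫ q in refTriangle, lineDeriv ℝ u q (1, 0) =
      ∫ t in (0 : ℝ)..1, (u (1 - t, t) - u (0, t)) := by
  rw [← integral_indicator measurableSet_refTriangle, Measure.volume_eq_prod,
    integral_prod_symm _ ((integrable_indicator_iff measurableSet_refTriangle).2
      (integrableOn_lineDeriv hu (1, 0))),
    intervalIntegral.integral_of_le zero_le_one, ← integral_Icc_eq_integral_Ioc,
    ← integral_indicator measurableSet_Icc]
  congr 1 with b
  by_cases hb : b ∈ Icc (0 : ℝ) 1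
  · rw [indicator_of_mem hb]
    have : ∀ a, refTriangle.indicator (fun q => lineDeriv ℝ u q (1, 0)) (a, b) =
        (Ioo 0 (1 - b)).indicator (fun a => deriv (fun s => u (s, b)) a) a := by
      intro a
      by_cases ha : a ∈ Ioo 0 (1 - b)
      · rw [indicator_of_mem ha, indicator_of_mem, lineDeriv_fst]
        exact ⟨ha.1, hb.1, by linarith [ha.2]⟩
      · rw [indicator_of_notMem ha, indicator_of_notMem]
        rintro ⟨h1, h2, h3⟩
        exact ha ⟨h1, by simp only at h3; linarith⟩
    simp_rw [this]
    rw [integral_indicator measurableSet_Ioo, ← integral_Ioc_eq_integral_Ioo,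
      ← intervalIntegral.integral_of_le (by linarith [hb.2])]
    exact integral_deriv_of_lipschitz (K := K * 1)
      (hu.comp (LipschitzWith.prodMk_right b)) _ _
  · rw [indicator_of_notMem hb]
    refine integral_eq_zero_of_ae (Filter.Eventually.of_forall fun a => indicator_of_notMem ?_ _)
    rintro ⟨h1, h2, h3⟩
    exact hb ⟨h2, by simp only at h1 h3; linarith⟩

theorem integral_refTriangle_snd {u : ℝ × ℝ → ℝ} {K : NNReal} (hu : LipschitzWith K u) :
    ∫ q in refTriangle, lineDeriv ℝ u q (0, 1) =
      ∫ t in (0 : ℝ)..1, (u (t, 1 - t) - u (t, 0)) := by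
  rw [← integral_indicator measurableSet_refTriangle, Measure.volume_eq_prod,
    integral_prod _ ((integrable_indicator_iff measurableSet_refTriangle).2
      (integrableOn_lineDeriv hu (0, 1))),
    intervalIntegral.integral_of_le zero_le_one,
    ← integral_indicator measurableSet_Ioc]
  congr 1 with a
  by_cases ha : a ∈ Ioc (0 : ℝ) 1
  · rw [indicator_of_mem ha]
    have : ∀ b, refTriangle.indicator (fun q => lineDeriv ℝ u q (0, 1)) (a, b) =
        (Ico 0 (1 - a)).indicator (fun b => deriv (fun s => u (a, s)) b) b := by
      intro b
      by_cases hb : b ∈ Ico 0 (1 - a)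
      · rw [indicator_of_mem hb, indicator_of_mem, lineDeriv_snd]
        exact ⟨ha.1, hb.1, by linarith [hb.2]⟩
      · rw [indicator_of_notMem hb, indicator_of_notMem]
        rintro ⟨h1, h2, h3⟩
        exact hb ⟨h2, by simp only at h3; linarith⟩
    simp_rw [this]
    rw [integral_indicator measurableSet_Ico, integral_Ico_eq_integral_Ioo,
      ← integral_Ioc_eq_integral_Ioo,
      ← intervalIntegral.integral_of_le (by linarith [ha.2])]
    exact integral_deriv_of_lipschitz (K := K * 1)
      (hu.comp (LipschitzWith.prodMk_left a)) _ _
  · rw [indicator_of_notMem ha]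
    refine integral_eq_zero_of_ae (Filter.Eventually.of_forall fun b => indicator_of_notMem ?_ _)
    rintro ⟨h1, h2, h3⟩
    exact ha ⟨h1, by simp only at h2 h3; linarith⟩

/-- The linear map `(α, β) ↦ α P + β R` on the plane. -/
def frameMap (P R : Plane) : Plane →ₗ[ℝ] Plane where
  toFun y := y 0 • P + y 1 • R
  map_add' x y := by simp [add_smul]; abel
  map_smul' r x := by simp [mul_smul]

theorem det_frameMap (P R : Plane) : LinearMap.det (frameMap P R) = cross P R := by
  rw [← LinearMap.det_toMatrix (EuclideanSpace.basisFun (Fin 2) ℝ).toBasis, Matrix.det_fin_two]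
  simp [LinearMap.toMatrix_apply, frameMap, cross]
  ring

/-- The affine parametrization `(α, β) ↦ z + α (a - z) + β (b - z)` of the plane. -/
def triParam (z a b : Plane) (q : ℝ × ℝ) : Plane := z + (q.1 • (a - z) + q.2 • (b - z))

theorem continuous_triParam (z a b : Plane) : Continuous (triParam z a b) := by
  unfold triParam; fun_prop

theorem map_triParam {z a b : Plane} (hD : 0 < cross (a - z) (b - z)) :
    Measure.map (triParam z a b) volume =
      ENNReal.ofReal (cross (a - z) (b - z))⁻¹ • (volume : Measure Plane) := by
  have h1 : triParam z a b = (fun x => z + x) ∘ frameMap (a - z) (b - z) ∘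
      (WithLp.toLp 2 : (Fin 2 → ℝ) → Plane) ∘ (MeasurableEquiv.finTwoArrow (α := ℝ)).symm := by
    ext q i
    simp [triParam, frameMap]
  have hm : Measurable (frameMap (a - z) (b - z)) :=
    (frameMap (a - z) (b - z)).continuous_of_finiteDimensional.measurable
  rw [h1, ← Measure.map_map (by fun_prop) (by fun_prop), ← Measure.map_map hm (by fun_prop),
    ← Measure.map_map (by fun_prop) (by fun_prop),
    (volume_preserving_finTwoArrow ℝ).symm.map_eq, (PiLp.volume_preserving_toLp (Fin 2)).map_eq,
    Measure.map_linearMap_addHaar_eq_smul_addHaar _ (by rw [det_frameMap]; exact hD.ne'),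
    Measure.map_smul, map_add_left_eq_self, det_frameMap, abs_of_pos (by positivity)]

theorem injective_triParam {z a b : Plane} (hD : 0 < cross (a - z) (b - z)) :
    Function.Injective (triParam z a b) := by
  rintro ⟨α, β⟩ ⟨α', β'⟩ h
  simp only [triParam, add_right_inj] at h
  have h1 := (cross_smul_add (a - z) (b - z) α β).1
  have h2 := (cross_smul_add (a - z) (b - z) α β).2
  rw [h, (cross_smul_add _ _ _ _).1] at h1
  rw [h, (cross_smul_add _ _ _ _).2] at h2
  rw [mul_right_cancel₀ hD.ne' h1, mul_right_cancel₀ hD.ne' h2]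

/-- The triangle with vertices `z`, `a`, `b` (in counter-clockwise order) without its edges `zb`
and `ab`: the points `z + α (a - z) + β (b - z)` with `0 < α`, `0 ≤ β`, `α + β < 1`. Omitting one of
the two edges at `z` makes the triangles of a fan around `z` disjoint; omitting `ab` makes the
triangle the increasing union of its contractions towards `z`. -/
def triangle (z a b : Plane) : Set Plane :=
  {x | 0 < cross (x - z) (b - z) ∧ 0 ≤ cross (a - z) (x - z) ∧
    cross (x - z) (b - z) + cross (a - z) (x - z) < cross (a - z) (b - z)}

theorem preimage_triangle {z a b : Plane} (hD : 0 < cross (a - z) (b - z)) :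
    triParam z a b ⁻¹' triangle z a b = refTriangle := by
  ext ⟨α, β⟩
  simp only [mem_preimage, triangle, refTriangle, mem_ofPred_eq, triParam, add_sub_cancel_left,
    (cross_smul_add (a - z) (b - z) α β).1, (cross_smul_add (a - z) (b - z) α β).2]
  rw [mul_pos_iff_of_pos_right hD, mul_nonneg_iff_of_pos_right hD, ← add_mul,
    mul_lt_iff_lt_one_left hD]

theorem continuous_cross {X : Type*} [TopologicalSpace X] {f g : X → Plane} (hf : Continuous f)
    (hg : Continuous g) : Continuous fun x => cross (f x) (g x) := by
  unfold cross
  fun_prop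

theorem measurableSet_triangle (z a b : Plane) : MeasurableSet (triangle z a b) := by
  have h1 : Continuous fun x : Plane => cross (x - z) (b - z) :=
    continuous_cross (by fun_prop) (by fun_prop)
  have h2 : Continuous fun x : Plane => cross (a - z) (x - z) :=
    continuous_cross (by fun_prop) (by fun_prop)
  exact (measurableSet_lt measurable_const h1.measurable).inter
    ((measurableSet_le measurable_const h2.measurable).inter
      (measurableSet_lt (h1.add h2).measurable measurable_const))

theorem setIntegral_triangle {z a b : Plane} (hD : 0 < cross (a - z) (b - z)) (h : Plane → ℝ) :
    ∫ x in triangle z a b, h x =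
      cross (a - z) (b - z) * ∫ q in refTriangle, h (triParam z a b q) := by
  have hemb : MeasurableEmbedding (triParam z a b) :=
    (continuous_triParam z a b).measurableEmbedding (injective_triParam hD)
  have h1 := hemb.setIntegral_map (μ := volume) h (triangle z a b)
  rw [preimage_triangle hD, map_triParam hD, Measure.restrict_smul, integral_smul_measure,
    ENNReal.toReal_ofReal (by positivity), smul_eq_mul] at h1
  rw [← h1, mul_inv_cancel_left₀ hD.ne']

theorem volume_triangle_le {z a b : Plane} (hD : 0 < cross (a - z) (b - z)) :
    volume (triangle z a b) ≤ ENNReal.ofReal (cross (a - z) (b - z)) := by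
  have hemb : MeasurableEmbedding (triParam z a b) :=
    (continuous_triParam z a b).measurableEmbedding (injective_triParam hD)
  have h1 := hemb.map_apply volume (triangle z a b)
  rw [preimage_triangle hD, map_triParam hD, Measure.smul_apply, smul_eq_mul,
    ENNReal.ofReal_inv_of_pos hD] at h1
  calc volume (triangle z a b)
      = ENNReal.ofReal (cross (a - z) (b - z)) * volume refTriangle := by
        rw [← h1, ← mul_assoc, ENNReal.mul_inv_cancel (by simpa using hD) (by simp), one_mul]
    _ ≤ ENNReal.ofReal (cross (a - z) (b - z)) * 1 := by gcongr; exact volume_refTriangle_le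
    _ = _ := mul_one _

/-- The mean value of `g` along the segment from `a` to `b`. -/
def segMean (g : Plane → ℝ) (a b : Plane) : ℝ := ∫ t in (0 : ℝ)..1, g (AffineMap.lineMap a b t)

theorem segMean_comm (g : Plane → ℝ) (a b : Plane) : segMean g a b = segMean g b a := by
  have := intervalIntegral.integral_comp_sub_left
    (fun t => g (AffineMap.lineMap (k := ℝ) a b t)) (a := 0) (b := 1) 1
  simp only [sub_self, sub_zero, AffineMap.lineMap_apply_one_sub] at this
  exact this.symm

theorem cross_smul_eq (P R c : Plane) :
    cross P R • c = cross c R • P + cross P c • R := by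
  ext i
  fin_cases i <;> simp [cross] <;> ring

theorem integral_triangle_fderiv_side {z a b : Plane} (hD : 0 < cross (a - z) (b - z))
    {g : Plane → ℝ} {K : NNReal} (hg : LipschitzWith K g) :
    ∫ x in triangle z a b, fderiv ℝ g x (a - z) =
      cross (a - z) (b - z) * (segMean g a b - segMean g z b) ∧
    ∫ x in triangle z a b, fderiv ℝ g x (b - z) =
      cross (a - z) (b - z) * (segMean g a b - segMean g z a) := by
  have hLip : ∃ K', LipschitzWith K' (triParam z a b) := by
    let A : ℝ × ℝ →L[ℝ] Plane := (ContinuousLinearMap.fst ℝ ℝ ℝ).smulRight (a - z) +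
      (ContinuousLinearMap.snd ℝ ℝ ℝ).smulRight (b - z)
    have h1 : triParam z a b = (fun y => z + y) ∘ A := by
      ext q; simp [triParam, A]
    rw [h1]
    exact ⟨_, (isometry_add_left z).lipschitz.comp A.lipschitz⟩
  obtain ⟨K', hK'⟩ := hLip
  have hu := hg.comp hK'
  have hae : ∀ᵐ q, DifferentiableAt ℝ g (triParam z a b q) := by
    have h1 : ∀ᵐ x ∂(Measure.map (triParam z a b) volume), DifferentiableAt ℝ g x := by
      rw [map_triParam hD]
      exact Measure.ae_smul_measure hg.ae_differentiableAt _
    exact ae_of_ae_map (continuous_triParam z a b).aemeasurable h1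
  have hseg : ∀ p q : Plane,
      IntervalIntegrable (fun t : ℝ => g (AffineMap.lineMap p q t)) volume 0 1 := fun p q =>
    (hg.continuous.comp AffineMap.lineMap_continuous).intervalIntegrable _ _
  have e1 : ∀ t, triParam z a b (1 - t, t) = AffineMap.lineMap a b t := fun t => by
    simp only [triParam, AffineMap.lineMap_apply_module']; module
  have e2 : ∀ t, triParam z a b (0, t) = AffineMap.lineMap z b t := fun t => by
    simp only [triParam, AffineMap.lineMap_apply_module']; module
  have e3 : ∀ t, triParam z a b (t, 1 - t) = AffineMap.lineMap b a t := fun t => by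
    simp only [triParam, AffineMap.lineMap_apply_module']; module
  have e4 : ∀ t, triParam z a b (t, 0) = AffineMap.lineMap z a t := fun t => by
    simp only [triParam, AffineMap.lineMap_apply_module']; module
  constructor
  · rw [setIntegral_triangle hD]
    congr 1
    calc ∫ q in refTriangle, fderiv ℝ g (triParam z a b q) (a - z)
        = ∫ q in refTriangle, lineDeriv ℝ (g ∘ triParam z a b) q (1, 0) := by
          refine integral_congr_ae (ae_restrict_of_ae ?_)
          filter_upwards [hae] with q hq
          rw [← hq.lineDeriv_eq_fderiv, lineDeriv, lineDeriv]
          congr 1 with t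
          simp only [Function.comp, triParam]
          congr 1
          simp only [Prod.fst_add, Prod.snd_add, Prod.smul_mk, smul_eq_mul]
          module
      _ = _ := integral_refTriangle_fst hu
      _ = _ := by
        simp only [Function.comp, e1, e2, segMean]
        exact intervalIntegral.integral_sub (hseg a b) (hseg z b)
  · rw [setIntegral_triangle hD]
    congr 1
    calc ∫ q in refTriangle, fderiv ℝ g (triParam z a b q) (b - z)
        = ∫ q in refTriangle, lineDeriv ℝ (g ∘ triParam z a b) q (0, 1) := by
          refine integral_congr_ae (ae_restrict_of_ae ?_)
          filter_upwards [hae] with q hq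
          rw [← hq.lineDeriv_eq_fderiv, lineDeriv, lineDeriv]
          congr 1 with t
          simp only [Function.comp, triParam]
          congr 1
          simp only [Prod.fst_add, Prod.snd_add, Prod.smul_mk, smul_eq_mul]
          module
      _ = _ := integral_refTriangle_snd hu
      _ = _ := by
        rw [segMean_comm g a b]
        simp only [Function.comp, e3, e4, segMean]
        exact intervalIntegral.integral_sub (hseg b a) (hseg z a)

theorem integrableOn_fderiv_apply {g : Plane → ℝ} {K : NNReal} (hg : LipschitzWith K g)
    {S : Set Plane} (hS : volume S ≠ ⊤) (c : Plane) :
    IntegrableOn (fun x => fderiv ℝ g x c) S := by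
  refine Measure.integrableOn_of_bounded (M := K * ‖c‖) hS
    (measurable_fderiv_apply_const ℝ g c).aestronglyMeasurable ?_
  refine Filter.Eventually.of_forall fun x => ?_
  exact (ContinuousLinearMap.le_opNorm _ _).trans
    (mul_le_mul_of_nonneg_right (norm_fderiv_le_of_lipschitz ℝ hg) (norm_nonneg _))

/-- The divergence theorem on a triangle, for the vector field `g c` with a constant direction `c`
and a Lipschitz function `g`. The flux through the segment from `a` to `b` is
`cross c (b - a)` times the mean of `g`. -/
theorem integral_triangle_fderiv {z a b : Plane} (hD : 0 < cross (a - z) (b - z))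
    {g : Plane → ℝ} {K : NNReal} (hg : LipschitzWith K g) (c : Plane) :
    ∫ x in triangle z a b, fderiv ℝ g x c =
      cross c (b - a) * segMean g a b - cross c (b - z) * segMean g z b +
        cross c (a - z) * segMean g z a := by
  have hfin : volume (triangle z a b) ≠ ⊤ :=
    ((volume_triangle_le hD).trans_lt ENNReal.ofReal_lt_top).ne
  have h1 : ∀ x, cross (a - z) (b - z) * fderiv ℝ g x c =
      cross c (b - z) * fderiv ℝ g x (a - z) + cross (a - z) c * fderiv ℝ g x (b - z) := by
    intro x
    have := congrArg (fderiv ℝ g x) (cross_smul_eq (a - z) (b - z) c)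
    simpa using this
  have h2 : cross (a - z) (b - z) * ∫ x in triangle z a b, fderiv ℝ g x c =
      cross c (b - z) * (∫ x in triangle z a b, fderiv ℝ g x (a - z)) +
      cross (a - z) c * ∫ x in triangle z a b, fderiv ℝ g x (b - z) := by
    rw [← integral_const_mul, ← integral_const_mul, ← integral_const_mul, ← integral_add
      ((integrableOn_fderiv_apply hg hfin _).const_mul _)
      ((integrableOn_fderiv_apply hg hfin _).const_mul _)]
    simp_rw [h1]
  rw [(integral_triangle_fderiv_side hD hg).1, (integral_triangle_fderiv_side hD hg).2] at h2
  refine mul_left_cancel₀ hD.ne' (h2.trans ?_)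
  have h3 : cross c (b - z) + cross (a - z) c = cross c (b - a) := by
    simp only [cross, PiLp.sub_apply]; ring
  have h4 : cross (a - z) c = - cross c (a - z) := by simp only [cross]; ring
  rw [← h3, h4]
  ring

/-! ### Functions of low regularity -/

/-- The regularity required of barycentric coordinates: continuity on `S`, local Lipschitz
continuity in the interior, and a square integrable gradient. On a convex compact set these
functions form an algebra containing the `C¹` functions. -/
structure H1Regular (S : Set Plane) (f : Plane → ℝ) : Prop where
  continuousOn : ContinuousOn f S
  locallyLipschitzOn : LocallyLipschitzOn (interior S) f
  memLp_gradientWithin : MemLp (gradientWithin f S) 2 (volume.restrict S)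

theorem ae_differentiableAt_of_locallyLipschitzOn {f : Plane → ℝ} {U : Set Plane} (hU : IsOpen U)
    (hf : LocallyLipschitzOn U f) : ∀ᵐ x ∂(volume.restrict U), DifferentiableAt ℝ f x := by
  rw [ae_restrict_iff' hU.measurableSet]
  rw [ae_iff]
  refine measure_null_of_locally_null _ fun x hx => ?_
  simp only [Classical.not_imp, mem_ofPred_eq] at hx
  obtain ⟨K, t, ht, hK⟩ := hf hx.1
  rw [hU.nhdsWithin_eq hx.1] at ht
  refine ⟨_, inter_mem_nhdsWithin _ (interior_mem_nhds.2 ht), measure_mono_null ?_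
    (ae_iff.1 hK.ae_differentiableWithinAt_of_mem)⟩
  rintro y ⟨hy1, hy2⟩
  simp only [Classical.not_imp, mem_ofPred_eq] at hy1 ⊢
  exact ⟨interior_subset hy2, fun h => hy1.2 (h.differentiableAt (mem_interior_iff_mem_nhds.1 hy2))⟩

theorem ae_mem_interior_of_convex {S : Set Plane} (hS : Convex ℝ S) :
    ∀ᵐ x ∂(volume.restrict S), x ∈ interior S := by
  have h := interior_ae_eq_of_null_frontier (hS.addHaar_frontier volume)
  rw [← Measure.restrict_congr_set h]
  exact ae_restrict_mem isOpen_interior.measurableSet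

theorem gradientWithin_of_mem_interior {S : Set Plane} {x : Plane} (hx : x ∈ interior S)
    (f : Plane → ℝ) : gradientWithin f S x = gradient f x := by
  rw [gradientWithin, gradient, fderivWithin_of_mem_nhds (mem_interior_iff_mem_nhds.1 hx)]

theorem gradientWithin_congr {S : Set Plane} {f g : Plane → ℝ} (h : EqOn f g S) {x : Plane}
    (hx : x ∈ S) : gradientWithin f S x = gradientWithin g S x := by
  rw [gradientWithin, gradientWithin, fderivWithin_congr h (h hx)]

theorem gradient_fun_add {f g : Plane → ℝ} {x : Plane} (hf : DifferentiableAt ℝ f x)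
    (hg : DifferentiableAt ℝ g x) :
    gradient (fun y => f y + g y) x = gradient f x + gradient g x := by
  simp only [gradient, fderiv_fun_add hf hg, map_add]

theorem gradient_fun_mul {f g : Plane → ℝ} {x : Plane} (hf : DifferentiableAt ℝ f x)
    (hg : DifferentiableAt ℝ g x) :
    gradient (fun y => f y * g y) x = f x • gradient g x + g x • gradient f x := by
  simp only [gradient, fderiv_fun_mul hf hg, map_add, map_smulₛₗ]
  simp

namespace H1Regular

variable {S : Set Plane} {f g : Plane → ℝ}

theorem ae_differentiableAt (hS : Convex ℝ S) (hf : H1Regular S f) :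
    ∀ᵐ x ∂(volume.restrict S), x ∈ interior S ∧ DifferentiableAt ℝ f x := by
  have h := interior_ae_eq_of_null_frontier (hS.addHaar_frontier volume)
  rw [← Measure.restrict_congr_set h]
  exact (ae_restrict_mem isOpen_interior.measurableSet).and
    (ae_differentiableAt_of_locallyLipschitzOn isOpen_interior hf.locallyLipschitzOn)

theorem congr (hS : Convex ℝ S) (hf : H1Regular S f) (h : EqOn g f S) : H1Regular S g where
  continuousOn := hf.continuousOn.congr h
  locallyLipschitzOn := fun x hx => by
    obtain ⟨K, t, ht, hK⟩ := hf.locallyLipschitzOn hx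
    refine ⟨K, t ∩ interior S, Filter.inter_mem ht self_mem_nhdsWithin, fun y hy w hw => ?_⟩
    rw [h (interior_subset hy.2), h (interior_subset hw.2)]
    exact hK hy.1 hw.1
  memLp_gradientWithin := by
    refine hf.memLp_gradientWithin.ae_eq ?_
    filter_upwards [ae_mem_interior_of_convex hS] with x hx
    exact (gradientWithin_congr h (interior_subset hx)).symm

theorem memLp_top (hS : IsCompact S) (hf : ContinuousOn f S) :
    MemLp f ⊤ (volume.restrict S) := by
  obtain ⟨C, hC⟩ := hS.exists_bound_of_continuousOn hf
  exact memLp_top_of_bound (hf.aestronglyMeasurable hS.isClosed.measurableSet) C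
    (ae_restrict_of_forall_mem hS.isClosed.measurableSet hC)

theorem gradientWithin_add (hS : Convex ℝ S) (hf : H1Regular S f) (hg : H1Regular S g) :
    gradientWithin (fun x => f x + g x) S =ᵐ[volume.restrict S]
      fun x => gradientWithin f S x + gradientWithin g S x := by
  filter_upwards [hf.ae_differentiableAt hS, hg.ae_differentiableAt hS] with x hx hx'
  simp only [gradientWithin_of_mem_interior hx.1, gradient_fun_add hx.2 hx'.2]

theorem gradientWithin_mul (hS : Convex ℝ S) (hf : H1Regular S f) (hg : H1Regular S g) :
    gradientWithin (fun x => f x * g x) S =ᵐ[volume.restrict S]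
      fun x => f x • gradientWithin g S x + g x • gradientWithin f S x := by
  filter_upwards [hf.ae_differentiableAt hS, hg.ae_differentiableAt hS] with x hx hx'
  simp only [gradientWithin_of_mem_interior hx.1, gradient_fun_mul hx.2 hx'.2]

theorem of_contDiff (hS : Convex ℝ S) (hc : IsCompact S) (hf : ContDiff ℝ 1 f) :
    H1Regular S f where
  continuousOn := hf.continuous.continuousOn
  locallyLipschitzOn := hf.locallyLipschitz.locallyLipschitzOn
  memLp_gradientWithin := by
    have h1 : Continuous (gradient f) := by
      unfold gradient
      exact (LinearIsometryEquiv.continuous _).comp (hf.continuous_fderiv (by norm_num))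
    obtain ⟨C, hC⟩ := hc.exists_bound_of_continuousOn h1.continuousOn
    have : IsFiniteMeasure (volume.restrict S) := ⟨by simpa using hc.measure_lt_top⟩
    have h2 : MemLp (gradient f) 2 (volume.restrict S) :=
      MemLp.of_bound h1.aestronglyMeasurable C
        (ae_restrict_of_forall_mem hc.isClosed.measurableSet hC)
    refine h2.ae_eq ?_
    filter_upwards [ae_mem_interior_of_convex hS] with x hx
    rw [gradientWithin_of_mem_interior hx]

theorem const (hS : Convex ℝ S) (hc : IsCompact S) (r : ℝ) : H1Regular S fun _ => r :=
  of_contDiff hS hc contDiff_const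

theorem add (hS : Convex ℝ S) (hf : H1Regular S f) (hg : H1Regular S g) :
    H1Regular S fun x => f x + g x where
  continuousOn := hf.continuousOn.add hg.continuousOn
  locallyLipschitzOn := by
    have h : LocallyLipschitz fun p : ℝ × ℝ => p.1 + p.2 :=
      (contDiff_fst.add contDiff_snd : ContDiff ℝ 1 _).locallyLipschitz
    rw [locallyLipschitzOn_iff_restrict]
    exact h.comp (hf.locallyLipschitzOn.restrict.prodMk hg.locallyLipschitzOn.restrict)
  memLp_gradientWithin := (hf.memLp_gradientWithin.add hg.memLp_gradientWithin).ae_eq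
    (gradientWithin_add hS hf hg).symm

theorem mul (hS : Convex ℝ S) (hc : IsCompact S) (hf : H1Regular S f) (hg : H1Regular S g) :
    H1Regular S fun x => f x * g x where
  continuousOn := hf.continuousOn.mul hg.continuousOn
  locallyLipschitzOn := by
    have h : LocallyLipschitz fun p : ℝ × ℝ => p.1 * p.2 :=
      (contDiff_fst.mul contDiff_snd : ContDiff ℝ 1 _).locallyLipschitz
    rw [locallyLipschitzOn_iff_restrict]
    exact h.comp (hf.locallyLipschitzOn.restrict.prodMk hg.locallyLipschitzOn.restrict)
  memLp_gradientWithin := by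
    refine MemLp.ae_eq (gradientWithin_mul hS hf hg).symm ?_
    exact (MemLp.smul (r := 2) hg.memLp_gradientWithin (memLp_top hc hf.continuousOn)).add
      (MemLp.smul (r := 2) hf.memLp_gradientWithin (memLp_top hc hg.continuousOn))

theorem sum (hS : Convex ℝ S) (hc : IsCompact S) {ι : Type*} (s : Finset ι)
    {F : ι → Plane → ℝ} (hF : ∀ i ∈ s, H1Regular S (F i)) :
    H1Regular S fun x => ∑ i ∈ s, F i x := by
  classical
  induction s using Finset.induction_on with
  | empty => simpa using const hS hc 0
  | insert i s hi ih =>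
    simp only [Finset.sum_insert hi]
    exact (hF i (by simp)).add hS (ih fun j hj => hF j (by simp [hj]))

theorem integrableOn (hc : IsCompact S) (hf : H1Regular S f) : IntegrableOn f S :=
  hf.continuousOn.integrableOn_compact hc

theorem integrableOn_gradientWithin (hc : IsCompact S) (hf : H1Regular S f) :
    IntegrableOn (gradientWithin f S) S := by
  have : IsFiniteMeasure (volume.restrict S) := ⟨by simpa using hc.measure_lt_top⟩
  exact hf.memLp_gradientWithin.integrable one_le_two

end H1Regular

theorem segMean_congr {f g : Plane → ℝ} {S : Set Plane} (hS : Convex ℝ S) (h : EqOn f g S)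
    {a b : Plane} (ha : a ∈ S) (hb : b ∈ S) : segMean f a b = segMean g a b := by
  unfold segMean
  refine intervalIntegral.integral_congr fun t ht => h ?_
  rw [uIcc_of_le zero_le_one] at ht
  exact hS.lineMap_mem ha hb ht

theorem tendsto_segMean {ι : Type*} {l : Filter ι} [l.IsCountablyGenerated] {S : Set Plane}
    (hS : Convex ℝ S) (hc : IsCompact S) {f : Plane → ℝ} (hf : ContinuousOn f S)
    {A B : ι → Plane} {a b : Plane} (hA : ∀ᶠ i in l, A i ∈ S) (hB : ∀ᶠ i in l, B i ∈ S)
    (ha : a ∈ S) (hb : b ∈ S) (hAa : Filter.Tendsto A l (nhds a))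
    (hBb : Filter.Tendsto B l (nhds b)) :
    Filter.Tendsto (fun i => segMean f (A i) (B i)) l (nhds (segMean f a b)) := by
  obtain ⟨C, hC⟩ := hc.exists_bound_of_continuousOn hf
  unfold segMean
  refine intervalIntegral.tendsto_integral_filter_of_dominated_convergence (fun _ => C) ?_ ?_
    (by simp) ?_
  · filter_upwards [hA, hB] with i hi hi'
    refine ContinuousOn.aestronglyMeasurable ?_ measurableSet_uIoc
    refine hf.comp (AffineMap.lineMap_continuous.continuousOn) fun t ht => ?_
    rw [uIoc_of_le zero_le_one] at ht
    exact hS.lineMap_mem hi hi' ⟨ht.1.le, ht.2⟩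
  · filter_upwards [hA, hB] with i hi hi'
    refine Filter.Eventually.of_forall fun t ht => ?_
    rw [uIoc_of_le zero_le_one] at ht
    exact hC _ (hS.lineMap_mem hi hi' ⟨ht.1.le, ht.2⟩)
  · refine Filter.Eventually.of_forall fun t ht => ?_
    rw [uIoc_of_le zero_le_one] at ht
    have ht' : t ∈ Icc (0 : ℝ) 1 := ⟨ht.1.le, ht.2⟩
    refine (hf _ (hS.lineMap_mem ha hb ht')).tendsto.comp (tendsto_nhdsWithin_iff.2 ⟨?_, ?_⟩)
    · simp only [AffineMap.lineMap_apply_module]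
      exact (hAa.const_smul _).add (hBb.const_smul _)
    · filter_upwards [hA, hB] with i hi hi'
      exact hS.lineMap_mem hi hi' ht'

theorem triParam_eq_of_mem {z a b x : Plane} (hD : 0 < cross (a - z) (b - z)) :
    x = triParam z a b (cross (x - z) (b - z) / cross (a - z) (b - z),
      cross (a - z) (x - z) / cross (a - z) (b - z)) := by
  have h := cross_smul_eq (a - z) (b - z) (x - z)
  rw [triParam]
  simp only [div_eq_inv_mul, mul_smul]
  rw [← smul_add, ← h, inv_smul_smul₀ hD.ne', add_sub_cancel]

theorem triParam_mem {S : Set Plane} (hS : Convex ℝ S) {z a b : Plane} (hz : z ∈ S)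
    (ha : a ∈ S) (hb : b ∈ S) {α β : ℝ} (hα : 0 ≤ α) (hβ : 0 ≤ β) (h : α + β ≤ 1) :
    triParam z a b (α, β) ∈ S := by
  have := hS.sum_mem (t := Finset.univ) (w := ![1 - α - β, α, β]) (z := ![z, a, b])
    (by intro i _; fin_cases i <;> simp <;> linarith) (by simp [Fin.sum_univ_three]; ring)
    (by intro i _; fin_cases i <;> simp [hz, ha, hb])
  convert this using 1
  simp only [Fin.sum_univ_three, triParam, cons_val_zero, cons_val_one, cons_val_two]
  simp only [head_cons, tail_cons]
  module

theorem triangle_subset {S : Set Plane} (hS : Convex ℝ S) {z a b : Plane} (hz : z ∈ S)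
    (ha : a ∈ S) (hb : b ∈ S) (hD : 0 < cross (a - z) (b - z)) : triangle z a b ⊆ S := by
  rintro x ⟨h1, h2, h3⟩
  rw [triParam_eq_of_mem (x := x) hD]
  refine triParam_mem hS hz ha hb (div_nonneg h1.le hD.le) (div_nonneg h2 hD.le) ?_
  rw [← add_div, div_le_one hD]
  exact h3.le

/-- The divergence theorem on a triangle in the interior of `S`: on such a compact set `f` is
Lipschitz, so that it may be replaced by a Lipschitz extension. -/
theorem H1Regular.integral_triangle_of_mem_interior {S : Set Plane} (hS : Convex ℝ S)
    {f : Plane → ℝ} (hf : H1Regular S f) {z a b : Plane} (hz : z ∈ interior S)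
    (ha : a ∈ interior S) (hb : b ∈ interior S) (hD : 0 < cross (a - z) (b - z)) (c : Plane) :
    ∫ x in triangle z a b, inner ℝ (gradientWithin f S x) c =
      cross c (b - a) * segMean f a b - cross c (b - z) * segMean f z b +
        cross c (a - z) * segMean f z a := by
  set H := convexHull ℝ ({z, a, b} : Set Plane) with hH
  have hHS : H ⊆ interior S := convexHull_min (by
    rintro x (rfl | rfl | rfl) <;> assumption) (Convex.interior (𝕜 := ℝ) hS)
  have hHc : Convex ℝ H := convex_convexHull ℝ _
  have hHk : IsCompact H := (Set.toFinite _).isCompact_convexHull (𝕜 := ℝ)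
  have hzH : z ∈ H := subset_convexHull ℝ _ (by simp)
  have haH : a ∈ H := subset_convexHull ℝ _ (by simp)
  have hbH : b ∈ H := subset_convexHull ℝ _ (by simp)
  obtain ⟨K, hK⟩ := LocallyLipschitzOn.exists_lipschitzOnWith_of_compact hHk
    (hf.locallyLipschitzOn.mono hHS)
  obtain ⟨g, hg, hfg⟩ := hK.extend_real
  rw [segMean_congr hHc hfg haH hbH, segMean_congr hHc hfg hzH hbH,
    segMean_congr hHc hfg hzH haH, ← integral_triangle_fderiv hD hg c]
  refine integral_congr_ae ?_
  have h1 := ae_restrict_of_ae_restrict_of_subset (triangle_subset hHc hzH haH hbH hD)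
    (ae_mem_interior_of_convex hHc)
  filter_upwards [h1] with x hx
  have h2 : f =ᶠ[nhds x] g :=
    Filter.eventuallyEq_of_mem (mem_interior_iff_mem_nhds.1 hx) hfg
  rw [gradientWithin_of_mem_interior (hHS (interior_subset hx)), inner_gradient_left,
    h2.fderiv_eq]

theorem cross_smul_smul (r : ℝ) (a b : Plane) :
    cross (r • a) b = r * cross a b ∧ cross a (r • b) = r * cross a b := by
  simp only [cross, PiLp.smul_apply, smul_eq_mul]
  constructor <;> ring

/-- The divergence theorem on a triangle with one vertex in the interior of `S`, by contracting
the triangle towards that vertex. -/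
theorem H1Regular.integral_triangle {S : Set Plane} (hS : Convex ℝ S) (hc : IsCompact S)
    {f : Plane → ℝ} (hf : H1Regular S f) {z a b : Plane} (hz : z ∈ interior S)
    (ha : a ∈ S) (hb : b ∈ S) (hD : 0 < cross (a - z) (b - z)) (c : Plane) :
    ∫ x in triangle z a b, inner ℝ (gradientWithin f S x) c =
      cross c (b - a) * segMean f a b - cross c (b - z) * segMean f z b +
        cross c (a - z) * segMean f z a := by
  have hzS := interior_subset hz
  let l : Filter ℝ := nhdsWithin 1 (Iio 1)
  have hl : ∀ᶠ ρ in l, ρ ∈ Ioo (0 : ℝ) 1 := Ioo_mem_nhdsLT one_pos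
  have hl1 : Filter.Tendsto (fun ρ : ℝ => ρ) l (nhds 1) := nhdsWithin_le_nhds
  let A : ℝ → Plane → Plane := fun ρ x => z + ρ • (x - z)
  have hAz : ∀ ρ x, A ρ x - z = ρ • (x - z) := fun ρ x => add_sub_cancel_left _ _
  have hAsub : ∀ ρ x y, A ρ x - A ρ y = ρ • (x - y) := fun ρ x y => by
    simp only [A]; module
  have hA : ∀ x ∈ S, ∀ ρ ∈ Ioo (0 : ℝ) 1, A ρ x ∈ interior S := fun x hx ρ hρ => by
    have := hS.combo_interior_self_mem_interior hz hx (a := 1 - ρ) (b := ρ)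
      (by linarith [hρ.2]) hρ.1.le (by ring)
    convert this using 1
    simp only [A]; module
  have hAlim : ∀ x, Filter.Tendsto (fun ρ => A ρ x) l (nhds x) := fun x => by
    have : Filter.Tendsto (fun ρ => A ρ x) l (nhds (A 1 x)) := by
      simp only [A]
      exact (hl1.smul_const _).const_add _
    simpa [A] using this
  have hDρ : ∀ ρ, cross (A ρ a - z) (A ρ b - z) = ρ * (ρ * cross (a - z) (b - z)) := fun ρ => by
    rw [hAz, hAz, (cross_smul_smul _ _ _).1, (cross_smul_smul _ _ _).2]
  -- membership in the contracted triangles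
  have hmem : ∀ ρ ∈ Ioo (0 : ℝ) 1, ∀ x, x ∈ triangle z (A ρ a) (A ρ b) ↔
      0 < cross (x - z) (b - z) ∧ 0 ≤ cross (a - z) (x - z) ∧
        cross (x - z) (b - z) + cross (a - z) (x - z) < ρ * cross (a - z) (b - z) := by
    intro ρ hρ x
    rw [triangle, mem_ofPred_eq, hDρ, hAz, hAz, (cross_smul_smul _ _ _).1,
      (cross_smul_smul _ _ _).2, mul_pos_iff_of_pos_left hρ.1, mul_nonneg_iff_of_pos_left hρ.1,
      ← mul_add, mul_lt_mul_iff_right₀ hρ.1]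
  have hint : IntegrableOn (fun x => inner ℝ (gradientWithin f S x) c) S :=
    (hf.integrableOn_gradientWithin hc).inner_const c
  have hlim1 : Filter.Tendsto (fun ρ => ∫ x in triangle z (A ρ a) (A ρ b),
      inner ℝ (gradientWithin f S x) c) l
      (nhds (∫ x in triangle z a b, inner ℝ (gradientWithin f S x) c)) := by
    simp_rw [← integral_indicator (measurableSet_triangle _ _ _)]
    have hsub : ∀ ρ ∈ Ioo (0 : ℝ) 1, triangle z (A ρ a) (A ρ b) ⊆ triangle z a b := by
      intro ρ hρ x hx
      obtain ⟨h1, h2, h3⟩ := (hmem ρ hρ x).1 hx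
      exact ⟨h1, h2, h3.trans_le (mul_le_of_le_one_left hD.le hρ.2.le)⟩
    have hintT := (hint.mono_set (triangle_subset hS hzS ha hb hD)).integrable_indicator
      (measurableSet_triangle z a b)
    refine tendsto_integral_filter_of_dominated_convergence _ ?_ ?_ hintT.norm ?_
    · filter_upwards [hl] with ρ hρ
      exact ((hint.mono_set ((hsub ρ hρ).trans (triangle_subset hS hzS ha hb hD))
        ).integrable_indicator (measurableSet_triangle _ _ _)).aestronglyMeasurable
    · filter_upwards [hl] with ρ hρ
      refine Filter.Eventually.of_forall fun x => ?_
      exact norm_indicator_le_of_subset (hsub ρ hρ) _ _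
    · refine Filter.Eventually.of_forall fun x => tendsto_nhds_of_eventually_eq ?_
      by_cases hx : x ∈ triangle z a b
      · have h4 : ∀ᶠ ρ in l, cross (x - z) (b - z) + cross (a - z) (x - z) <
            ρ * cross (a - z) (b - z) :=
          (hl1.mul_const (cross (a - z) (b - z))).eventually_const_lt (by simpa using hx.2.2)
        filter_upwards [hl, h4] with ρ hρ h4
        rw [indicator_of_mem hx, indicator_of_mem ((hmem ρ hρ x).2 ⟨hx.1, hx.2.1, h4⟩)]
      · filter_upwards [hl] with ρ hρ
        rw [indicator_of_notMem hx, indicator_of_notMem fun h => hx (hsub ρ hρ h)]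
  have hAS : ∀ x ∈ S, ∀ᶠ ρ in l, A ρ x ∈ S := fun x hx => by
    filter_upwards [hl] with ρ hρ using interior_subset (hA x hx ρ hρ)
  have hcr : ∀ p q, Filter.Tendsto (fun ρ => cross c (ρ • (p - q))) l (nhds (cross c (p - q))) :=
    fun p q => by
      simp_rw [(cross_smul_smul _ _ _).2]
      simpa using hl1.mul_const (cross c (p - q))
  have hlim2 := (((hcr b a).mul (tendsto_segMean hS hc hf.continuousOn (hAS a ha) (hAS b hb)
    ha hb (hAlim a) (hAlim b))).sub ((hcr b z).mul (tendsto_segMean hS hc hf.continuousOn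
    (Filter.Eventually.of_forall fun _ => hzS) (hAS b hb) hzS hb tendsto_const_nhds
    (hAlim b)))).add ((hcr a z).mul (tendsto_segMean hS hc hf.continuousOn
    (Filter.Eventually.of_forall fun _ => hzS) (hAS a ha) hzS ha tendsto_const_nhds
    (hAlim a)))
  have : l.NeBot := inferInstanceAs (nhdsWithin (1 : ℝ) (Iio 1)).NeBot
  refine tendsto_nhds_unique hlim1 (hlim2.congr' ?_)
  filter_upwards [hl] with ρ hρ
  rw [hf.integral_triangle_of_mem_interior hS hz (hA a ha ρ hρ) (hA b hb ρ hρ)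
    (by rw [hDρ]; exact mul_pos hρ.1 (mul_pos hρ.1 hD)), hAz, hAz, hAsub]

/-! ### Geometry of convex polygons and the divergence theorem -/

theorem exists_add_smul_mem {S : Set Plane} {x : Plane} (hx : x ∈ interior S) (w : Plane) :
    ∃ t : ℝ, 0 < t ∧ x + t • w ∈ S := by
  have h1 : Filter.Tendsto (fun t : ℝ => x + t • w) (nhdsWithin 0 (Ioi 0)) (nhds x) := by
    have : Continuous fun t : ℝ => x + t • w := by fun_prop
    simpa using (this.tendsto 0).mono_left (nhdsWithin_le_nhds (s := Ioi 0))
  obtain ⟨t, h2, h3⟩ := ((h1.eventually (mem_interior_iff_mem_nhds.1 hx)).and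
    (self_mem_nhdsWithin)).exists
  exact ⟨t, h3, h2⟩

theorem isLinearMap_cross (e : Plane) : IsLinearMap ℝ (cross e) where
  map_add x y := by simp [cross]; ring
  map_smul r x := by simp [cross]; ring

theorem cross_sub (e x y : Plane) : cross e (x - y) = cross e x - cross e y :=
  (isLinearMap_cross e).map_sub x y

theorem cross_comm (a b : Plane) : cross a b = -cross b a := by
  simp only [cross]; ring

namespace ConvexPolygon

variable {n : ℕ} (T : ConvexPolygon n)

theorem val_finRotate (i : Fin n) : (finRotate n i : ℕ) = (i + 1) % n := by
  have := i.neZero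
  rw [finRotate_apply, Fin.val_add, Fin.val_one', Nat.add_mod_mod]

theorem finRotate_ne (h : 3 ≤ n) (i : Fin n) :
    finRotate n i ≠ i ∧ finRotate n (finRotate n i) ≠ i := by
  have := i.isLt
  simp only [ne_eq, Fin.ext_iff, val_finRotate]
  rcases Nat.lt_or_ge (i + 1 : ℕ) n with h1 | h1
  · rw [Nat.mod_eq_of_lt h1]
    refine ⟨by omega, ?_⟩
    rcases Nat.lt_or_ge (i + 1 + 1 : ℕ) n with h2 | h2
    · rw [Nat.mod_eq_of_lt h2]; omega
    · rw [Nat.mod_eq_sub_mod h2, Nat.mod_eq_of_lt (by omega)]; omega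
  · rw [show (i + 1 : ℕ) = n by omega, Nat.mod_self, Nat.mod_eq_of_lt (by omega)]
    omega

/-- The cyclic successor acts transitively: `b` is reached from `a` in fewer than `n` steps. -/
theorem exists_iterate_finRotate (a b : Fin n) : ∃ k < n, (finRotate n)^[k] a = b := by
  have h1 : ∀ k : ℕ, ((finRotate n)^[k] a : ℕ) = (a + k) % n := by
    intro k
    induction k with
    | zero => simp [Nat.mod_eq_of_lt a.isLt]
    | succ k ih => rw [Function.iterate_succ_apply', val_finRotate, ih, Nat.mod_add_mod, add_assoc]
  have ha := a.isLt
  have hb := b.isLt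
  rcases Nat.lt_or_ge (b : ℕ) a with h | h
  · refine ⟨n + b - a, by omega, Fin.ext ?_⟩
    rw [h1, show (a : ℕ) + (n + b - a) = n + b by omega, Nat.add_mod_left, Nat.mod_eq_of_lt hb]
  · refine ⟨b - a, by omega, Fin.ext ?_⟩
    rw [h1, show (a : ℕ) + (b - a) = b by omega, Nat.mod_eq_of_lt hb]

theorem convex_region : Convex ℝ T.region := convex_convexHull ℝ _

theorem isCompact_region : IsCompact T.region :=
  (Set.finite_range T.vert).isCompact_convexHull ℝ

theorem vert_mem (i : Fin n) : T.vert i ∈ T.region :=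
  subset_convexHull ℝ _ (mem_range_self i)

/-- The edge vector from the `i`-th vertex to its successor. -/
def edge (i : Fin n) : Plane := T.vert (finRotate n i) - T.vert i

theorem cross_edge_nonneg (i : Fin n) {x : Plane} (hx : x ∈ T.region) :
    0 ≤ cross (T.edge i) (x - T.vert i) := by
  have h1 : T.region ⊆ {x | cross (T.edge i) (T.vert i) ≤ cross (T.edge i) x} := by
    refine convexHull_min ?_ (convex_halfSpace_ge (isLinearMap_cross _) _)
    rintro _ ⟨j, rfl⟩
    rw [mem_ofPred_eq, ← sub_nonneg, ← cross_sub]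
    by_cases h1 : j = i
    · simp [h1, cross]
    by_cases h2 : j = finRotate n i
    · rw [h2, edge, cross]; apply le_of_eq; ring
    · exact (T.ccw i j h1 h2).le
  rw [cross_sub]
  exact sub_nonneg.2 (h1 hx)

theorem eq_or_eq_of_cross_edge_eq_zero {i j : Fin n}
    (h : cross (T.edge i) (T.vert j - T.vert i) = 0) : j = i ∨ j = finRotate n i := by
  by_contra! hne
  exact (T.ccw i j hne.1 hne.2).ne' h

theorem cross_edge_pos (i : Fin n) {x : Plane} (hx : x ∈ interior T.region) :
    0 < cross (T.edge i) (x - T.vert i) := by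
  obtain ⟨t, ht, hm⟩ := exists_add_smul_mem hx
    (T.vert i - T.vert (finRotate n (finRotate n i)))
  have hne := finRotate_ne T.three_le
  have h1 := T.cross_edge_nonneg i hm
  have h2 := T.ccw i _ (hne i).2 (hne (finRotate n i)).1
  simp only [edge, cross_sub, (isLinearMap_cross _).map_add, (isLinearMap_cross _).map_smul,
    smul_eq_mul] at *
  nlinarith

theorem cross_vert_eq (i : Fin n) (z : Plane) :
    cross (T.vert i - z) (T.vert (finRotate n i) - z) = cross (T.edge i) (z - T.vert i) := by
  simp only [edge, cross, PiLp.sub_apply]; ring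

/-- The third inequality defining a triangle of the fan around `z` says that `x` lies strictly to
the left of the edge. -/
theorem cross_sub_add_cross (i : Fin n) (z x : Plane) :
    cross (x - z) (T.vert (finRotate n i) - z) + cross (T.vert i - z) (x - z) =
      cross (T.vert i - z) (T.vert (finRotate n i) - z) - cross (T.edge i) (x - T.vert i) := by
  simp only [edge, cross, PiLp.sub_apply]; ring

/-- The triangle spanned by `z` and the `i`-th edge. -/
def fan (z : Plane) (i : Fin n) : Set Plane := triangle z (T.vert i) (T.vert (finRotate n i))

/-- The triangles spanned by an interior point and the edges cover the interior: going around the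
polygon, the vertices pass from the right to the left of the ray from `z` through `x`. -/
theorem exists_mem_fan {z x : Plane} (hz : z ∈ interior T.region) (hx : x ∈ interior T.region)
    (hne : x ≠ z) : ∃ i, x ∈ T.fan z i := by
  set s : Fin n → ℝ := fun j => cross (x - z) (T.vert j - z) with hs
  have hlin := isLinearMap_cross (x - z)
  obtain ⟨a, ha⟩ : ∃ a, s a ≤ 0 := by
    by_contra! h
    have h1 : T.region ⊆ {y | cross (x - z) z < cross (x - z) y} := by
      refine convexHull_min ?_ (convex_halfSpace_gt hlin _)
      rintro _ ⟨j, rfl⟩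
      have := h j
      rw [hs] at this
      simp only [cross_sub] at this
      rw [mem_ofPred_eq]; linarith
    exact lt_irrefl (cross (x - z) z) (h1 (interior_subset hz))
  obtain ⟨b, hb⟩ : ∃ b, 0 < s b := by
    by_contra! h
    have h1 : T.region ⊆ {y | cross (x - z) y ≤ cross (x - z) z} := by
      refine convexHull_min ?_ (convex_halfSpace_le hlin _)
      rintro _ ⟨j, rfl⟩
      have := h j
      rw [hs] at this
      simp only [cross_sub] at this
      rw [mem_ofPred_eq]; linarith
    obtain ⟨t, ht, hm⟩ := exists_add_smul_mem hz (!₂[-(x - z) 1, (x - z) 0] : Plane)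
    have h2 := h1 hm
    rw [mem_ofPred_eq, hlin.map_add, hlin.map_smul, smul_eq_mul] at h2
    have h3 : cross (x - z) (!₂[-(x - z) 1, (x - z) 0] : Plane) =
        (x - z) 0 ^ 2 + (x - z) 1 ^ 2 := by
      simp [cross]; ring
    rw [h3] at h2
    have h4 : (x - z) 0 ^ 2 + (x - z) 1 ^ 2 ≤ 0 := by nlinarith
    have h5 : (x - z) 0 = 0 := by nlinarith [sq_nonneg ((x - z) 0), sq_nonneg ((x - z) 1)]
    have h6 : (x - z) 1 = 0 := by nlinarith [sq_nonneg ((x - z) 0), sq_nonneg ((x - z) 1)]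
    refine hne (sub_eq_zero.1 ?_)
    ext i
    fin_cases i
    · exact h5
    · exact h6
  obtain ⟨i, hi1, hi2⟩ : ∃ i, s i ≤ 0 ∧ 0 < s (finRotate n i) := by
    by_contra! h
    obtain ⟨k, -, hk⟩ := exists_iterate_finRotate a b
    have : ∀ k, s ((finRotate n)^[k] a) ≤ 0 := by
      intro k
      induction k with
      | zero => exact ha
      | succ k ih => rw [Function.iterate_succ_apply']; exact h _ ih
    exact absurd hb (not_lt.2 (hk ▸ this k))
  refine ⟨i, hi2, ?_, ?_⟩
  · rw [cross_comm]; exact neg_nonneg.2 hi1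
  · rw [T.cross_sub_add_cross i z x]
    linarith [T.cross_edge_pos i hx]

theorem fan_subset {z : Plane} (hz : z ∈ interior T.region) (i : Fin n) :
    T.fan z i ⊆ T.region :=
  triangle_subset T.convex_region (interior_subset hz) (T.vert_mem _) (T.vert_mem _)
    (by rw [cross_vert_eq]; exact T.cross_edge_pos i hz)

/-- The triangles of the fan are disjoint: for `x` in two of them, comparing the gauges of `x`
with respect to the two edge lines shows that each edge meets the line of the other one at its
first vertex, which strict convexity forbids for different edges. -/
theorem fan_disjoint (z : Plane) {i j : Fin n} (hij : i ≠ j) :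
    Disjoint (T.fan z i) (T.fan z j) := by
  rw [Set.disjoint_left]
  intro x hxi hxj
  have key : ∀ i j : Fin n,
      cross (T.vert i - z) (T.vert (finRotate n i) - z) *
        (cross (T.edge j) (z - T.vert j) - cross (T.edge j) (x - T.vert j)) =
      (cross (T.edge i) (z - T.vert i) - cross (T.edge i) (x - T.vert i)) *
        cross (T.edge j) (z - T.vert j) -
        cross (x - z) (T.vert (finRotate n i) - z) * cross (T.edge j) (T.vert i - T.vert j) -
        cross (T.vert i - z) (x - z) *
          cross (T.edge j) (T.vert (finRotate n i) - T.vert j) := by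
    intro i j
    have h1 := congrArg (cross (T.edge j))
      (cross_smul_eq (T.vert i - z) (T.vert (finRotate n i) - z) (x - z))
    have h2 := T.cross_sub_add_cross i z x
    rw [T.cross_vert_eq i z] at h1 h2 ⊢
    have hl := isLinearMap_cross (T.edge j)
    simp only [hl.map_add, hl.map_smul, hl.map_sub, smul_eq_mul] at h1 ⊢
    linear_combination -h1 + (cross (T.edge j) z - cross (T.edge j) (T.vert j)) * h2
  have hi := key i j
  have hj := key j i
  rw [T.cross_vert_eq] at hi hj
  have p1 := mul_nonneg hxi.1.le (T.cross_edge_nonneg j (T.vert_mem i))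
  have p2 := mul_nonneg hxi.2.1 (T.cross_edge_nonneg j (T.vert_mem (finRotate n i)))
  have p3 := mul_nonneg hxj.1.le (T.cross_edge_nonneg i (T.vert_mem j))
  have p4 := mul_nonneg hxj.2.1 (T.cross_edge_nonneg i (T.vert_mem (finRotate n j)))
  have z1 : cross (T.edge j) (T.vert i - T.vert j) = 0 :=
    (mul_eq_zero.1 (by linarith : cross (x - z) (T.vert (finRotate n i) - z) *
      cross (T.edge j) (T.vert i - T.vert j) = 0)).resolve_left hxi.1.ne'
  have z2 : cross (T.edge i) (T.vert j - T.vert i) = 0 :=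
    (mul_eq_zero.1 (by linarith : cross (x - z) (T.vert (finRotate n j) - z) *
      cross (T.edge i) (T.vert j - T.vert i) = 0)).resolve_left hxj.1.ne'
  have e1 := (T.eq_or_eq_of_cross_edge_eq_zero z1).resolve_left hij
  have e2 := (T.eq_or_eq_of_cross_edge_eq_zero z2).resolve_left hij.symm
  rw [e1] at e2
  exact (finRotate_ne T.three_le j).2 e2.symm

theorem iUnion_fan_ae_eq {z : Plane} (hz : z ∈ interior T.region) :
    (⋃ i, T.fan z i) =ᵐ[volume] T.region := by
  refine (iUnion_subset fun i => T.fan_subset hz i).eventuallyLE.antisymm ?_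
  rw [ae_le_set]
  refine measure_mono_null (t := frontier T.region ∪ {z}) ?_
    (measure_union_null (T.convex_region.addHaar_frontier volume) (by simp))
  rintro x ⟨hx, hx'⟩
  by_contra h
  simp only [mem_union, mem_singleton_iff, not_or] at h
  have hxi : x ∈ interior T.region := by
    by_contra hxi
    exact h.1 ⟨subset_closure hx, hxi⟩
  obtain ⟨i, hi⟩ := T.exists_mem_fan hz hxi h.2
  exact hx' (mem_iUnion.2 ⟨i, hi⟩)

theorem setIntegral_region {z : Plane} (hz : z ∈ interior T.region) {f : Plane → ℝ}
    (hf : IntegrableOn f T.region) : ∫ x in T.region, f x = ∑ i, ∫ x in T.fan z i, f x := by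
  rw [← setIntegral_congr_set (T.iUnion_fan_ae_eq hz), integral_iUnion_fintype (s := T.fan z)
    (fun i => measurableSet_triangle _ _ _) (fun i j hij => T.fan_disjoint z hij)
    (fun i => hf.mono_set (T.fan_subset hz i))]

/-- The divergence theorem on a convex polygon, for the vector field `f c` with a constant
direction `c`. -/
theorem integral_inner_gradientWithin {f : Plane → ℝ} (hf : H1Regular T.region f)
    (hne : (interior T.region).Nonempty) (c : Plane) :
    ∫ x in T.region, inner ℝ (gradientWithin f T.region x) c =
      ∑ i, cross c (T.edge i) * segMean f (T.vert i) (T.vert (finRotate n i)) := by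
  obtain ⟨z, hz⟩ := hne
  rw [T.setIntegral_region hz
    ((hf.integrableOn_gradientWithin T.isCompact_region).inner_const c)]
  have h1 : ∀ i, ∫ x in T.fan z i, inner ℝ (gradientWithin f T.region x) c =
      cross c (T.edge i) * segMean f (T.vert i) (T.vert (finRotate n i)) -
      cross c (T.vert (finRotate n i) - z) * segMean f z (T.vert (finRotate n i)) +
      cross c (T.vert i - z) * segMean f z (T.vert i) := fun i =>
    hf.integral_triangle T.convex_region T.isCompact_region hz (T.vert_mem _) (T.vert_mem _)
      (by rw [cross_vert_eq]; exact T.cross_edge_pos i hz) c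
  simp_rw [h1]
  rw [Finset.sum_add_distrib, Finset.sum_sub_distrib, Equiv.sum_comp (finRotate n)
    fun i => cross c (T.vert i - z) * segMean f z (T.vert i)]
  ring

end ConvexPolygon

/-! ### The nodal increment along an edge -/

/-- The linear functional `cross e`. -/
def crossCLM (e : Plane) : Plane →L[ℝ] ℝ :=
  LinearMap.toContinuousLinearMap (isLinearMap_cross e).mk'

theorem crossCLM_apply (e x : Plane) : crossCLM e x = cross e x := rfl

theorem H1Regular.integrableOn_norm_sq {S : Set Plane} {f : Plane → ℝ} (hf : H1Regular S f) :
    IntegrableOn (fun x => ‖gradientWithin f S x‖ ^ 2) S :=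
  hf.memLp_gradientWithin.integrable_norm_pow two_ne_zero

theorem H1Regular.integrableOn_norm {S : Set Plane} (hc : IsCompact S) {f : Plane → ℝ}
    (hf : H1Regular S f) : IntegrableOn (fun x => ‖gradientWithin f S x‖) S :=
  Integrable.norm (hf.integrableOn_gradientWithin hc)

theorem H1Regular.integrableOn_inner {S : Set Plane} (hc : IsCompact S) {f : Plane → ℝ}
    (hf : H1Regular S f) (c : Plane) :
    IntegrableOn (fun x => (inner ℝ (gradientWithin f S x) c : ℝ)) S :=
  Integrable.inner_const (hf.integrableOn_gradientWithin hc) c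

theorem H1Regular.integral_norm_gradientWithin_triangle_le {S : Set Plane} (hS : Convex ℝ S)
    (hc : IsCompact S) {f : Plane → ℝ} (hf : H1Regular S f) {z a b : Plane} (hz : z ∈ S)
    (ha : a ∈ S) (hb : b ∈ S) (hD : 0 < cross (a - z) (b - z)) :
    ∫ x in triangle z a b, ‖gradientWithin f S x‖ ≤
      √(cross (a - z) (b - z)) * seminormH1 S f := by
  set D := cross (a - z) (b - z) with hDdef
  set I := ∫ x in triangle z a b, ‖gradientWithin f S x‖ with hI
  set J := ∫ x in triangle z a b, ‖gradientWithin f S x‖ ^ 2 with hJ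
  have hsub := triangle_subset hS hz ha hb hD
  have hfin : volume (triangle z a b) ≠ ⊤ :=
    ((volume_triangle_le hD).trans_lt ENNReal.ofReal_lt_top).ne
  have hV : volume.real (triangle z a b) ≤ D :=
    ENNReal.toReal_le_of_le_ofReal hD.le (volume_triangle_le hD)
  have i1 : IntegrableOn (fun x => ‖gradientWithin f S x‖) (triangle z a b) :=
    (hf.integrableOn_norm hc).mono_set hsub
  have i2 := hf.integrableOn_norm_sq.mono_set hsub
  have hJle : J ≤ ∫ x in S, ‖gradientWithin f S x‖ ^ 2 :=
    setIntegral_mono_set hf.integrableOn_norm_sq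
      (Filter.Eventually.of_forall fun x => sq_nonneg _) hsub.eventuallyLE
  -- the Cauchy-Schwarz inequality `I ^ 2 ≤ D J`, from the square of `D ‖∇f‖ - I`
  have h0 : 0 ≤ ∫ x in triangle z a b, (D * ‖gradientWithin f S x‖ - I) ^ 2 :=
    integral_nonneg fun x => sq_nonneg _
  have h1 : ∫ x in triangle z a b, (D * ‖gradientWithin f S x‖ - I) ^ 2 =
      D ^ 2 * J - 2 * D * I * I + volume.real (triangle z a b) * I ^ 2 := by
    have : ∀ x, (D * ‖gradientWithin f S x‖ - I) ^ 2 =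
        D ^ 2 * ‖gradientWithin f S x‖ ^ 2 - 2 * D * I * ‖gradientWithin f S x‖ + I ^ 2 :=
      fun x => by ring
    simp_rw [this]
    have ic : IntegrableOn (fun _ : Plane => I ^ 2) (triangle z a b) :=
      integrableOn_const hfin
    have i3 : IntegrableOn (fun x => D ^ 2 * ‖gradientWithin f S x‖ ^ 2 -
        2 * D * I * ‖gradientWithin f S x‖) (triangle z a b) :=
      (i2.const_mul _).sub (i1.const_mul _)
    rw [integral_add i3 ic,
      integral_sub (i2.const_mul _) (i1.const_mul _), integral_const_mul, integral_const_mul,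
      setIntegral_const, smul_eq_mul]
  have h2 : I ^ 2 ≤ D * J := by
    rw [h1] at h0
    have : volume.real (triangle z a b) * I ^ 2 ≤ D * I ^ 2 :=
      mul_le_mul_of_nonneg_right hV (sq_nonneg _)
    have h3 : 0 ≤ D * (D * J - I ^ 2) := by nlinarith
    linarith [nonneg_of_mul_nonneg_right h3 hD]
  rw [seminormH1, ← Real.sqrt_mul hD.le]
  exact Real.le_sqrt_of_sq_le (h2.trans (mul_le_mul_of_nonneg_left hJle hD.le))

/-- Testing a trace against the tangential derivative of a stream function. If
`∂_{a-z} A = ∂_{b-z} B`, `A` vanishes on the edge `zb` and `B` on the edge `za`, then the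
divergence theorem expresses the integral of `f (A - B)` along `ab` by the gradient of `f` on the
triangle. The resulting bound is invariant under similarities. -/
theorem H1Regular.abs_segMean_mul_le {S : Set Plane} (hS : Convex ℝ S) (hc : IsCompact S)
    {f : Plane → ℝ} (hf : H1Regular S f) {z a b : Plane} (hz : z ∈ interior S)
    (ha : a ∈ S) (hb : b ∈ S) (hD : 0 < cross (a - z) (b - z)) {A B : Plane → ℝ}
    (hA : ContDiff ℝ 1 A) (hB : ContDiff ℝ 1 B)
    (hAB : ∀ x, fderiv ℝ A x (a - z) = fderiv ℝ B x (b - z))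
    (hA0 : ∀ t : ℝ, A (AffineMap.lineMap z b t) = 0)
    (hB0 : ∀ t : ℝ, B (AffineMap.lineMap z a t) = 0) {m : ℝ}
    (hAm : ∀ x ∈ triangle z a b, |A x| ≤ m) (hBm : ∀ x ∈ triangle z a b, |B x| ≤ m) :
    √(cross (a - z) (b - z)) * |segMean (fun x => f x * (A x - B x)) a b| ≤
      m * (‖a - z‖ + ‖b - z‖) * seminormH1 S f := by
  have hzS := interior_subset hz
  have hAr := H1Regular.of_contDiff hS hc hA
  have hBr := H1Regular.of_contDiff hS hc hB
  have hfA := hf.mul hS hc hAr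
  have hfB := hf.mul hS hc hBr
  set D := cross (a - z) (b - z) with hDdef
  have hsub := triangle_subset hS hzS ha hb hD
  have t1 := hfA.integral_triangle hS hc hz ha hb hD (a - z)
  have t2 := hfB.integral_triangle hS hc hz ha hb hD (b - z)
  have s1 : segMean (fun x => f x * A x) z b = 0 := by simp [segMean, hA0]
  have s2 : segMean (fun x => f x * B x) z a = 0 := by simp [segMean, hB0]
  have c1 : cross (a - z) (b - a) = D := by simp only [hDdef, cross, PiLp.sub_apply]; ring
  have c2 : cross (b - z) (b - a) = D := by simp only [hDdef, cross, PiLp.sub_apply]; ring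
  have c3 : ∀ p : Plane, cross p p = 0 := fun p => by simp only [cross]; ring
  have s3 : segMean (fun x => f x * (A x - B x)) a b =
      segMean (fun x => f x * A x) a b - segMean (fun x => f x * B x) a b := by
    have hi : ∀ g : Plane → ℝ, H1Regular S g →
        IntervalIntegrable (fun t : ℝ => g (AffineMap.lineMap a b t)) volume 0 1 := fun g hg => by
      refine ContinuousOn.intervalIntegrable ?_
      refine hg.continuousOn.comp AffineMap.lineMap_continuous.continuousOn fun t ht => ?_
      rw [uIcc_of_le zero_le_one] at ht
      exact hS.lineMap_mem ha hb ht
    unfold segMean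
    rw [← intervalIntegral.integral_sub (hi _ hfA) (hi _ hfB)]
    simp_rw [mul_sub]
  rw [s1, c1, c3] at t1
  rw [s2, c2, c3] at t2
  have hiA := (hfA.integrableOn_inner hc (a - z)).mono_set hsub
  have hiB := (hfB.integrableOn_inner hc (b - z)).mono_set hsub
  have e1 : D * segMean (fun x => f x * (A x - B x)) a b =
      ∫ x in triangle z a b, (A x * inner ℝ (gradientWithin f S x) (a - z) -
        B x * inner ℝ (gradientWithin f S x) (b - z)) := by
    rw [s3, mul_sub]
    have : D * segMean (fun x => f x * A x) a b - D * segMean (fun x => f x * B x) a b =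
        (∫ x in triangle z a b, inner ℝ (gradientWithin (fun x => f x * A x) S x) (a - z)) -
        ∫ x in triangle z a b, inner ℝ (gradientWithin (fun x => f x * B x) S x) (b - z) := by
      rw [t1, t2]; ring
    rw [this, ← integral_sub hiA hiB]
    refine integral_congr_ae ?_
    filter_upwards [ae_restrict_of_ae_restrict_of_subset hsub (hf.gradientWithin_mul hS hAr),
      ae_restrict_of_ae_restrict_of_subset hsub (hf.gradientWithin_mul hS hBr),
      ae_restrict_of_ae_restrict_of_subset hsub (ae_mem_interior_of_convex hS)] with x h1 h2 h3
    rw [h1, h2, inner_add_left, inner_add_left, real_inner_smul_left, real_inner_smul_left,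
      real_inner_smul_left, real_inner_smul_left, gradientWithin_of_mem_interior h3 A,
      gradientWithin_of_mem_interior h3 B, inner_gradient_left, inner_gradient_left, hAB]
    ring
  have hm : 0 ≤ m := by
    have : triParam z a b (1 / 2, 0) ∈ triangle z a b := by
      rw [← mem_preimage, preimage_triangle hD]
      simp only [refTriangle, mem_ofPred_eq]; norm_num
    exact (abs_nonneg _).trans (hAm _ this)
  have e2 : |D * segMean (fun x => f x * (A x - B x)) a b| ≤
      m * (‖a - z‖ + ‖b - z‖) * (√D * seminormH1 S f) := by
    rw [e1, ← Real.norm_eq_abs]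
    refine (norm_integral_le_of_norm_le (g := fun x => m * (‖a - z‖ + ‖b - z‖) *
      ‖gradientWithin f S x‖) ?_ ?_).trans ?_
    · exact ((hf.integrableOn_norm hc).mono_set hsub).const_mul _
    · refine ae_restrict_of_forall_mem (measurableSet_triangle _ _ _) fun x hx => ?_
      have q1 := abs_real_inner_le_norm (gradientWithin f S x) (a - z)
      have q2 := abs_real_inner_le_norm (gradientWithin f S x) (b - z)
      calc _ ≤ |A x| * |inner ℝ (gradientWithin f S x) (a - z)| +
            |B x| * |inner ℝ (gradientWithin f S x) (b - z)| := by
            rw [← abs_mul, ← abs_mul]; exact norm_sub_le _ _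
        _ ≤ m * (‖gradientWithin f S x‖ * ‖a - z‖) + m * (‖gradientWithin f S x‖ * ‖b - z‖) := by
            gcongr
            · exact hAm x hx
            · exact hBm x hx
        _ = _ := by ring
    · rw [integral_const_mul]
      exact mul_le_mul_of_nonneg_left
        (hf.integral_norm_gradientWithin_triangle_le hS hc hzS ha hb hD) (by positivity)
  have hs : 0 < √D := Real.sqrt_pos.2 hD
  have hDs : D = √D * √D := (Real.mul_self_sqrt hD.le).symm
  rw [abs_mul, abs_of_pos hD] at e2
  refine le_of_mul_le_mul_left ?_ hs
  calc √D * (√D * |segMean (fun x => f x * (A x - B x)) a b|)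
      = D * |segMean (fun x => f x * (A x - B x)) a b| := by rw [← mul_assoc, ← hDs]
    _ ≤ _ := e2
    _ = _ := by ring

theorem integral_quartic (k₀ k₁ k₂ k₃ k₄ : ℝ) :
    ∫ t in (0 : ℝ)..1, (k₀ + k₁ * t + k₂ * t ^ 2 + k₃ * t ^ 3 + k₄ * t ^ 4) =
      k₀ + k₁ / 2 + k₂ / 3 + k₃ / 4 + k₄ / 5 := by
  rw [intervalIntegral.integral_eq_sub_of_hasDerivAt
    (f := fun t => k₀ * t + k₁ / 2 * t ^ 2 + k₂ / 3 * t ^ 3 + k₃ / 4 * t ^ 4 + k₄ / 5 * t ^ 5)]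
  · ring
  · intro t _
    have h := (((((hasDerivAt_id' t).const_mul k₀).fun_add
      ((hasDerivAt_pow 2 t).const_mul (k₁ / 2))).fun_add
      ((hasDerivAt_pow 3 t).const_mul (k₂ / 3))).fun_add
      ((hasDerivAt_pow 4 t).const_mul (k₃ / 4))).fun_add
      ((hasDerivAt_pow 5 t).const_mul (k₄ / 5))
    refine h.congr_deriv ?_
    push_cast
    ring
  · exact Continuous.intervalIntegrable (by fun_prop) _ _

/-- A function which is quadratic along the edge `ab` of a triangle has increments to the midpoint
and to the other end of the edge that are bounded by its `H¹` seminorm. The test functions are the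
derivatives of the stream functions `α β` and `α β (α - β)` in barycentric coordinates; they
determine the two nonconstant coefficients of the quadratic. -/
theorem H1Regular.increment_le_of_quadratic {S : Set Plane} (hS : Convex ℝ S) (hc : IsCompact S)
    {f : Plane → ℝ} (hf : H1Regular S f) {z a b : Plane} (hz : z ∈ interior S)
    (ha : a ∈ S) (hb : b ∈ S) (hD : 0 < cross (a - z) (b - z)) {c₀ c₁ c₂ : ℝ}
    (hq : ∀ t ∈ Icc (0 : ℝ) 1, f (AffineMap.lineMap a b t) = c₀ + c₁ * t + c₂ * t ^ 2) :
    √(cross (a - z) (b - z)) * |f b - f a| ≤ 18 * (‖a - z‖ + ‖b - z‖) * seminormH1 S f ∧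
    √(cross (a - z) (b - z)) * |f (midpoint ℝ a b) - f a| ≤
      18 * (‖a - z‖ + ‖b - z‖) * seminormH1 S f := by
  set D := cross (a - z) (b - z) with hDdef
  let l : Plane →L[ℝ] ℝ := (-D⁻¹) • crossCLM (b - z)
  let k : Plane →L[ℝ] ℝ := D⁻¹ • crossCLM (a - z)
  have hcc : ∀ p : Plane, cross p p = 0 := fun p => by simp only [cross]; ring
  have l1 : l (a - z) = 1 := by
    simp only [l, _root_.smul_apply, crossCLM_apply, smul_eq_mul]
    rw [cross_comm, ← hDdef, neg_mul_neg, inv_mul_cancel₀ hD.ne']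
  have l2 : l (b - z) = 0 := by
    simp [l, crossCLM_apply, hcc]
  have k1 : k (a - z) = 0 := by
    simp [k, crossCLM_apply, hcc]
  have k2 : k (b - z) = 1 := by
    simp only [k, _root_.smul_apply, crossCLM_apply, smul_eq_mul]
    rw [← hDdef, inv_mul_cancel₀ hD.ne']
  -- the barycentric coordinates of the triangle
  let α : Plane → ℝ := fun x => l (x - z)
  let β : Plane → ℝ := fun x => k (x - z)
  have hα : ∀ x, HasFDerivAt α l x := fun x => by
    simpa using! l.hasFDerivAt.comp x ((hasFDerivAt_id x).sub_const z)
  have hβ : ∀ x, HasFDerivAt β k x := fun x => by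
    simpa using! k.hasFDerivAt.comp x ((hasFDerivAt_id x).sub_const z)
  have cα : ContDiff ℝ 1 α := l.contDiff.comp (contDiff_id.sub contDiff_const)
  have cβ : ContDiff ℝ 1 β := k.contDiff.comp (contDiff_id.sub contDiff_const)
  have hT : ∀ x ∈ triangle z a b, 0 ≤ α x ∧ 0 ≤ β x ∧ α x + β x ≤ 1 := by
    rintro x ⟨h1, h2, h3⟩
    have e1 : α x = D⁻¹ * cross (x - z) (b - z) := by
      simp only [α, l, _root_.smul_apply, crossCLM_apply, smul_eq_mul]
      rw [cross_comm (b - z), neg_mul_neg]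
    have e2 : β x = D⁻¹ * cross (a - z) (x - z) := rfl
    have hDi : 0 < D⁻¹ := inv_pos.2 hD
    refine ⟨by rw [e1]; positivity, by rw [e2]; positivity, ?_⟩
    rw [e1, e2, ← mul_add, inv_mul_le_one₀ hD]
    exact h3.le
  have lzb : ∀ t : ℝ, α (AffineMap.lineMap z b t) = 0 := fun t => by
    simp only [α, AffineMap.lineMap_apply_module', add_sub_cancel_right, map_smul, l2, smul_zero]
  have kza : ∀ t : ℝ, β (AffineMap.lineMap z a t) = 0 := fun t => by
    simp only [β, AffineMap.lineMap_apply_module', add_sub_cancel_right, map_smul, k1, smul_zero]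
  have lab : ∀ t : ℝ, AffineMap.lineMap a b t - z = (1 - t) • (a - z) + t • (b - z) := fun t => by
    rw [AffineMap.lineMap_apply_module]; module
  have αab : ∀ t : ℝ, α (AffineMap.lineMap a b t) = 1 - t := fun t => by
    simp only [α, lab, map_add, map_smul, l1, l2, smul_eq_mul]; ring
  have βab : ∀ t : ℝ, β (AffineMap.lineMap a b t) = t := fun t => by
    simp only [β, lab, map_add, map_smul, k1, k2, smul_eq_mul]; ring
  have T1 := hf.abs_segMean_mul_le hS hc hz ha hb hD (A := α) (B := β) (m := 1) cα cβ
    (fun x => by rw [(hα x).fderiv, (hβ x).fderiv, l1, k2]) lzb kza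
    (fun x hx => by
      obtain ⟨h1, h2, h3⟩ := hT x hx
      rw [abs_le]; constructor <;> linarith)
    (fun x hx => by
      obtain ⟨h1, h2, h3⟩ := hT x hx
      rw [abs_le]; constructor <;> linarith)
  have T2 := hf.abs_segMean_mul_le hS hc hz ha hb hD (A := fun x => α x * (α x - 2 * β x))
    (B := fun x => β x * (2 * α x - β x)) (m := 2)
    (cα.mul (cα.sub (contDiff_const.mul cβ))) (cβ.mul ((contDiff_const.mul cα).sub cβ))
    (fun x => by
      have h1 := ((hα x).fun_mul ((hα x).fun_sub ((hβ x).const_mul 2))).fderiv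
      have h2 := ((hβ x).fun_mul (((hα x).const_mul 2).fun_sub (hβ x))).fderiv
      rw [h1, h2]
      simp [l1, l2, k1, k2]
      ring)
    (fun t => by simp [lzb]) (fun t => by simp [kza])
    (fun x hx => by
      obtain ⟨h1, h2, h3⟩ := hT x hx
      rw [abs_mul]
      calc |α x| * |α x - 2 * β x| ≤ 1 * 2 := by
            gcongr
            · rw [abs_le]; constructor <;> linarith
            · rw [abs_le]; constructor <;> linarith
        _ = 2 := by norm_num)
    (fun x hx => by
      obtain ⟨h1, h2, h3⟩ := hT x hx
      rw [abs_mul]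
      calc |β x| * |2 * α x - β x| ≤ 1 * 2 := by
            gcongr
            · rw [abs_le]; constructor <;> linarith
            · rw [abs_le]; constructor <;> linarith
        _ = 2 := by norm_num)
  have I1 : segMean (fun x => f x * (α x - β x)) a b = -(c₁ + c₂) / 6 := by
    have : segMean (fun x => f x * (α x - β x)) a b =
        ∫ t in (0 : ℝ)..1, (c₀ + (c₁ - 2 * c₀) * t + (c₂ - 2 * c₁) * t ^ 2 +
          (-2 * c₂) * t ^ 3 + 0 * t ^ 4) := by
      refine intervalIntegral.integral_congr fun t ht => ?_
      rw [uIcc_of_le zero_le_one] at ht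
      simp only [hq t ht, αab, βab]; ring
    rw [this, integral_quartic]; ring
  have I2 : segMean (fun x => f x * (α x * (α x - 2 * β x) - β x * (2 * α x - β x))) a b =
      c₂ / 30 := by
    have : segMean (fun x => f x * (α x * (α x - 2 * β x) - β x * (2 * α x - β x))) a b =
        ∫ t in (0 : ℝ)..1, (c₀ + (c₁ - 6 * c₀) * t + (c₂ - 6 * c₁ + 6 * c₀) * t ^ 2 +
          (6 * c₁ - 6 * c₂) * t ^ 3 + (6 * c₂) * t ^ 4) := by
      refine intervalIntegral.integral_congr fun t ht => ?_
      rw [uIcc_of_le zero_le_one] at ht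
      simp only [hq t ht, αab, βab]; ring
    rw [this, integral_quartic]; ring
  have fa : f a = c₀ := by simpa using hq 0 (by simp)
  have fb : f b = c₀ + c₁ + c₂ := by simpa using hq 1 (by simp)
  have fm : f (midpoint ℝ a b) = c₀ + c₁ / 2 + c₂ / 4 := by
    have := hq (1 / 2) (by norm_num)
    have e : midpoint ℝ a b = AffineMap.lineMap a b (1 / 2 : ℝ) := by
      rw [midpoint, one_div, invOf_eq_inv]
    rw [e, this]; ring
  rw [I1] at T1
  rw [I2] at T2
  set X := (‖a - z‖ + ‖b - z‖) * seminormH1 S f with hX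
  have hs := Real.sqrt_nonneg D
  have hX0 : 0 ≤ X := by unfold X seminormH1; positivity
  have U1 : √D * |c₁ + c₂| ≤ 6 * X := by
    rw [neg_div, abs_neg, abs_div, abs_of_pos (by norm_num : (0:ℝ) < 6)] at T1
    rw [hX]; linarith
  have U2 : √D * |c₂| ≤ 60 * X := by
    rw [abs_div, abs_of_pos (by norm_num : (0:ℝ) < 30)] at T2
    rw [hX]; linarith
  constructor
  · rw [fa, fb, show c₀ + c₁ + c₂ - c₀ = c₁ + c₂ by ring]
    nlinarith
  · rw [fa, fm, show c₀ + c₁ / 2 + c₂ / 4 - c₀ = (c₁ + c₂) / 2 - c₂ / 4 by ring]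
    have h1 : |(c₁ + c₂) / 2 - c₂ / 4| ≤ |c₁ + c₂| / 2 + |c₂| / 4 := by
      refine (abs_sub _ _).trans ?_
      rw [abs_div, abs_div, abs_of_pos (by norm_num : (0:ℝ) < 2),
        abs_of_pos (by norm_num : (0:ℝ) < 4)]
    have h2 := mul_le_mul_of_nonneg_left h1 hs
    rw [mul_assoc, ← hX]
    linarith

/-! ### Shape-regular polygons -/

namespace ConvexPolygon

variable {n : ℕ} (T : ConvexPolygon n)

theorem edge_ne_zero (i : Fin n) : T.edge i ≠ 0 := by
  intro h
  have hne := finRotate_ne T.three_le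
  have := T.ccw i _ (hne i).2 (hne (finRotate n i)).1
  rw [show T.vert (finRotate n i) - T.vert i = 0 from h] at this
  simp [cross] at this

/-- A ball in the polygon keeps its radius as distance to the edge lines. -/
theorem norm_edge_mul_le {z : Plane} {r : ℝ} (hr : 0 < r)
    (hball : Metric.closedBall z r ⊆ T.region) (i : Fin n) :
    ‖T.edge i‖ * r ≤ cross (T.edge i) (z - T.vert i) := by
  set e := T.edge i with he
  have hL : 0 < ‖e‖ := norm_pos_iff.2 (T.edge_ne_zero i)
  set w : Plane := !₂[-e 1, e 0] with hw
  have hn : ‖e‖ ^ 2 = e 0 ^ 2 + e 1 ^ 2 := by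
    rw [EuclideanSpace.norm_sq_eq, Fin.sum_univ_two]; simp
  have hwn : ‖w‖ = ‖e‖ := by
    have : ‖w‖ ^ 2 = ‖e‖ ^ 2 := by
      rw [hn, EuclideanSpace.norm_sq_eq, Fin.sum_univ_two]; simp [hw]; ring
    exact (pow_left_inj₀ (norm_nonneg _) (norm_nonneg _) two_ne_zero).1 this
  have hcw : cross e w = ‖e‖ ^ 2 := by rw [hn]; simp [cross, hw]; ring
  have hm : z - (r / ‖e‖) • w ∈ T.region := hball (by
    rw [Metric.mem_closedBall, dist_eq_norm, sub_sub_cancel_left, norm_neg, norm_smul, hwn,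
      Real.norm_of_nonneg (by positivity), div_mul_cancel₀ _ hL.ne'])
  have h1 := T.cross_edge_nonneg i hm
  have hl := isLinearMap_cross e
  rw [← he, hl.map_sub, hl.map_sub, hl.map_smul, hcw, smul_eq_mul] at h1
  rw [hl.map_sub]
  have h2 : r / ‖e‖ * ‖e‖ ^ 2 = ‖e‖ * r := by field_simp
  linarith

theorem dist_le_diam {x y : Plane} (hx : x ∈ T.region) (hy : y ∈ T.region) :
    ‖x - y‖ ≤ Metric.diam T.region := by
  rw [← dist_eq_norm]
  exact Metric.dist_le_diam_of_mem T.isCompact_region.isBounded hx hy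

/-- Each edge is the base of a triangle in the polygon with an apex in the interior, whose shape
is controlled by the aspect ratio: the apex is the midpoint of the edge, moved towards the centre
of an inscribed ball by a distance proportional to the length of the edge. -/
theorem exists_apex {γ : ℝ} (hT : AspectRatioLE T.region γ) (i : Fin n) :
    ∃ z ∈ interior T.region,
      0 < cross (T.vert i - z) (T.vert (finRotate n i) - z) ∧
      ‖T.vert i - z‖ + ‖T.vert (finRotate n i) - z‖ ≤
        4 * √γ * √(cross (T.vert i - z) (T.vert (finRotate n i) - z)) := by
  obtain ⟨z₀, r, hr, hball, hdiam⟩ := hT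
  have hz₀ : z₀ ∈ interior T.region :=
    interior_mono hball (by
      rw [mem_interior_iff_mem_nhds]; exact Metric.closedBall_mem_nhds _ hr)
  set d := Metric.diam T.region with hd
  set e := T.edge i with he
  have hL : 0 < ‖e‖ := norm_pos_iff.2 (T.edge_ne_zero i)
  have hLd : ‖e‖ ≤ d := T.dist_le_diam (T.vert_mem _) (T.vert_mem _)
  have hd0 : 0 < d := hL.trans_le hLd
  have hγ : 0 < γ := pos_of_mul_pos_left (hd0.trans_le hdiam) hr.le
  set m := midpoint ℝ (T.vert i) (T.vert (finRotate n i)) with hm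
  have hmem : m ∈ T.region := T.convex_region.midpoint_mem (T.vert_mem _) (T.vert_mem _)
  set lam := ‖e‖ / d with hlam
  have hlam0 : 0 < lam := div_pos hL hd0
  have hlam1 : lam ≤ 1 := (div_le_one hd0).2 hLd
  have hz : (1 - lam) • m + lam • z₀ ∈ interior T.region := by
    rw [add_comm]
    exact T.convex_region.combo_interior_self_mem_interior hz₀ hmem hlam0 (by linarith) (by ring)
  set z := (1 - lam) • m + lam • z₀ with hzdef
  have hmi : T.vert i - m = -(1 / 2 : ℝ) • e := by
    rw [hm, midpoint_eq_smul_add, he, edge, invOf_eq_inv]; module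
  have hmn : T.vert (finRotate n i) - m = (1 / 2 : ℝ) • e := by
    rw [hm, midpoint_eq_smul_add, he, edge, invOf_eq_inv]; module
  have hcross : cross e (z - T.vert i) = lam * cross e (z₀ - T.vert i) := by
    have h1 : z - T.vert i = (1 - lam) • ((1 / 2 : ℝ) • e) + lam • (z₀ - T.vert i) := by
      rw [show (1 / 2 : ℝ) • e = -(T.vert i - m) by rw [hmi]; module, hzdef]; module
    have hl := isLinearMap_cross e
    have hee : cross e e = 0 := by simp only [cross]; ring
    rw [h1, hl.map_add, hl.map_smul, hl.map_smul, hl.map_smul, hee]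
    simp
  have hD : ‖e‖ ^ 2 ≤ γ * cross (T.vert i - z) (T.vert (finRotate n i) - z) := by
    rw [T.cross_vert_eq, ← he, hcross]
    have h1 := T.norm_edge_mul_le hr hball i
    calc ‖e‖ ^ 2 = lam * (‖e‖ * d) := by rw [hlam]; field_simp
      _ ≤ lam * (‖e‖ * (γ * r)) := by gcongr
      _ = γ * (lam * (‖e‖ * r)) := by ring
      _ ≤ _ := by gcongr
  have hDpos : 0 < cross (T.vert i - z) (T.vert (finRotate n i) - z) :=
    pos_of_mul_pos_right ((pow_pos hL 2).trans_le hD) hγ.le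
  refine ⟨z, hz, hDpos, ?_⟩
  have hLs : ‖e‖ ≤ √γ * √(cross (T.vert i - z) (T.vert (finRotate n i) - z)) := by
    rw [← Real.sqrt_mul hγ.le]; exact Real.le_sqrt_of_sq_le hD
  have hmz : ‖m - z‖ ≤ ‖e‖ := by
    have : m - z = lam • (m - z₀) := by rw [hzdef]; module
    rw [this, norm_smul, Real.norm_of_nonneg hlam0.le]
    calc lam * ‖m - z₀‖ ≤ lam * d := by
          gcongr; exact T.dist_le_diam hmem (interior_subset hz₀)
      _ = ‖e‖ := by rw [hlam]; field_simp
  have b1 : ‖T.vert i - z‖ ≤ 2 * ‖e‖ := by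
    rw [← sub_add_sub_cancel _ m]
    refine (norm_add_le _ _).trans ?_
    rw [hmi, norm_smul]
    norm_num
    linarith
  have b2 : ‖T.vert (finRotate n i) - z‖ ≤ 2 * ‖e‖ := by
    rw [← sub_add_sub_cancel _ m]
    refine (norm_add_le _ _).trans ?_
    rw [hmn, norm_smul]
    norm_num
    linarith
  linarith

theorem volume_region_le {h : ℝ} (hh : Metric.diam T.region ≤ h) :
    volume.real T.region ≤ Real.pi * h ^ 2 := by
  have hn := T.three_le
  have hd : 0 ≤ h := Metric.diam_nonneg.trans hh
  have hsub : T.region ⊆ Metric.closedBall (T.vert ⟨0, by omega⟩) h := fun x hx => by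
    rw [Metric.mem_closedBall, dist_eq_norm]
    exact (T.dist_le_diam hx (T.vert_mem _)).trans hh
  have h1 : volume.real T.region ≤ volume.real (Metric.closedBall (T.vert ⟨0, by omega⟩) h) :=
    measureReal_mono hsub measure_closedBall_lt_top.ne
  refine h1.trans (le_of_eq ?_)
  rw [measureReal_def, EuclideanSpace.volume_closedBall_fin_two]
  simp [ENNReal.toReal_ofReal hd, ENNReal.toReal_ofReal Real.pi_pos.le]
  ring

/-- On the `i`-th edge only the two barycentric coordinates of its ends are different from zero,
and they are linear. -/
theorem IsBarycentric.eq_on_edge {T : ConvexPolygon n} {φ : Fin n → Plane → ℝ}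
    (hφ : T.IsBarycentric φ) (i : Fin n) {t : ℝ} (ht : t ∈ Icc (0 : ℝ) 1) (j : Fin n) :
    φ j (AffineMap.lineMap (T.vert i) (T.vert (finRotate n i)) t) =
      (if j = i then 1 else 0) + ((if j = finRotate n i then 1 else 0) -
        (if j = i then 1 else 0)) * t := by
  set x := AffineMap.lineMap (T.vert i) (T.vert (finRotate n i)) t with hx
  have hxm : x ∈ T.region := T.convex_region.lineMap_mem (T.vert_mem _) (T.vert_mem _) ht
  have hl := isLinearMap_cross (T.edge i)
  have hxe : x - T.vert i = t • T.edge i := by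
    rw [hx, AffineMap.lineMap_apply_module', edge]; module
  have hsum : ∑ j, φ j x • (T.vert j - T.vert i) = x - T.vert i := by
    simp_rw [smul_sub]
    rw [Finset.sum_sub_distrib, hφ.linear x hxm, ← Finset.sum_smul, hφ.sum_one x hxm, one_smul]
  have hzero : ∀ j, j ≠ i → j ≠ finRotate n i → φ j x = 0 := by
    intro j h1 h2
    have h3 : ∑ j, φ j x * cross (T.edge i) (T.vert j - T.vert i) = 0 := by
      have := congrArg hl.mk' hsum
      rw [map_sum, hxe] at this
      simp only [map_smul, IsLinearMap.mk'_apply, smul_eq_mul] at this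
      rw [this, show cross (T.edge i) (T.edge i) = 0 by simp only [cross]; ring, mul_zero]
    have h4 := (Finset.sum_eq_zero_iff_of_nonneg fun j _ =>
      mul_nonneg (hφ.nonneg j x hxm) (T.cross_edge_nonneg i (T.vert_mem j))).1 h3 j
      (Finset.mem_univ j)
    exact (mul_eq_zero.1 h4).resolve_right (T.ccw i j h1 h2).ne'
  have hne := (finRotate_ne T.three_le i).1
  have h1 : φ (finRotate n i) x = t := by
    rw [Fintype.sum_eq_single (finRotate n i) fun j hj => ?_, hxe] at hsum
    · exact smul_left_injective ℝ (T.edge_ne_zero i) hsum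
    · by_cases hji : j = i
      · simp [hji]
      · simp [hzero j hji hj]
  have h2 : φ i x = 1 - t := by
    have := hφ.sum_one x hxm
    rw [Fintype.sum_eq_add i (finRotate n i) hne.symm fun j hj => hzero j hj.1 hj.2, h1] at this
    linarith
  by_cases hji : j = i
  · rw [hji, h2, if_pos rfl, if_neg hne.symm]; ring
  by_cases hjn : j = finRotate n i
  · rw [hjn, h1, if_pos rfl, if_neg hne]; ring
  · rw [hzero j hji hjn, if_neg hji, if_neg hjn]; ring

end ConvexPolygon

/-! ### The element space and the quadrature error -/

namespace QuadraticElement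

variable {n : ℕ} (E : QuadraticElement n)

theorem h1Regular_bary (a : Fin n) : H1Regular E.region (E.bary a) :=
  ⟨E.isBarycentric.continuousOn a, E.isBarycentric.locallyLipschitz a,
    E.isBarycentric.memLp_gradient a⟩

theorem h1Regular_shapeFun (k : Fin n ⊕ Fin n) :
    H1Regular E.region (shapeFun E.bary E.coef k) := by
  have hS := E.convex_region
  have hc := E.isCompact_region
  unfold shapeFun
  exact H1Regular.sum hS hc _ fun a _ => H1Regular.sum hS hc _ fun b _ =>
    ((H1Regular.const hS hc _).mul hS hc (E.h1Regular_bary a)).mul hS hc (E.h1Regular_bary b)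

theorem h1Regular_of_mem_space {v : Plane → ℝ} (hv : v ∈ E.space) : H1Regular E.region v := by
  obtain ⟨d, hd⟩ := hv
  have hS := E.convex_region
  have hc := E.isCompact_region
  exact (H1Regular.sum hS hc Finset.univ fun k _ =>
    (H1Regular.const hS hc (d k)).mul hS hc (E.h1Regular_shapeFun k)).congr hS hd

theorem node_mem (k : Fin n ⊕ Fin n) : E.node k ∈ E.region := by
  rcases k with i | i
  · exact E.vert_mem i
  · exact E.convex_region.midpoint_mem (E.vert_mem _) (E.vert_mem _)

theorem eq_sum_node {v : Plane → ℝ} (hv : v ∈ E.space) {x : Plane} (hx : x ∈ E.region) :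
    v x = ∑ k, v (E.node k) * shapeFun E.bary E.coef k x := by
  obtain ⟨d, hd⟩ := hv
  have h1 : ∀ k, v (E.node k) = d k := fun k => by
    rw [hd _ (E.node_mem k)]
    simp [E.kronecker]
  simp_rw [h1]
  exact hd x hx

theorem abs_shapeFun_le {M : ℝ} (hM : ∀ k a b, |E.coef k a b| ≤ M) (k : Fin n ⊕ Fin n)
    {x : Plane} (hx : x ∈ E.region) : |shapeFun E.bary E.coef k x| ≤ M := by
  have hφ := E.isBarycentric
  calc |shapeFun E.bary E.coef k x|
      ≤ ∑ a, ∑ b, |E.coef k a b * E.bary a x * E.bary b x| :=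
        (Finset.abs_sum_le_sum_abs _ _).trans
          (Finset.sum_le_sum fun a _ => Finset.abs_sum_le_sum_abs _ _)
    _ ≤ ∑ a, ∑ b, M * E.bary a x * E.bary b x := by
        gcongr with a _ b _
        rw [abs_mul, abs_mul, abs_of_nonneg (hφ.nonneg a x hx), abs_of_nonneg (hφ.nonneg b x hx)]
        exact mul_le_mul_of_nonneg_right
          (mul_le_mul_of_nonneg_right (hM k a b) (hφ.nonneg a x hx)) (hφ.nonneg b x hx)
    _ = M := by
        simp_rw [← Finset.mul_sum, hφ.sum_one x hx, mul_one, ← Finset.mul_sum, hφ.sum_one x hx,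
          mul_one]

theorem const_mem_polyFun (m : ℕ) (r : ℝ) : (fun _ : Plane => r) ∈ polyFun m :=
  mem_polyFun.2 ⟨MvPolynomial.C r, by simp, fun x => by simp⟩

/-- The functions of the element space are quadratic along the edges. -/
theorem exists_quadratic_on_edge {v : Plane → ℝ} (hv : v ∈ E.space) (i : Fin n) :
    ∃ c₀ c₁ c₂ : ℝ, ∀ t ∈ Icc (0 : ℝ) 1,
      v (AffineMap.lineMap (E.vert i) (E.vert (finRotate n i)) t) =
        c₀ + c₁ * t + c₂ * t ^ 2 := by
  obtain ⟨d, hd⟩ := hv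
  let u : Fin n → ℝ := fun j => if j = i then 1 else 0
  let w : Fin n → ℝ := fun j => (if j = finRotate n i then 1 else 0) - if j = i then 1 else 0
  refine ⟨∑ k, ∑ a, ∑ b, d k * E.coef k a b * (u a * u b),
    ∑ k, ∑ a, ∑ b, d k * E.coef k a b * (u a * w b + w a * u b),
    ∑ k, ∑ a, ∑ b, d k * E.coef k a b * (w a * w b), fun t ht => ?_⟩
  rw [hd _ (E.convex_region.lineMap_mem (E.vert_mem _) (E.vert_mem _) ht)]
  simp_rw [shapeFun, E.isBarycentric.eq_on_edge i ht, Finset.mul_sum, Finset.sum_mul,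
    ← Finset.sum_add_distrib]
  refine Finset.sum_congr rfl fun k _ => Finset.sum_congr rfl fun a _ =>
    Finset.sum_congr rfl fun b _ => ?_
  simp only [u, w]
  ring

theorem increment_le {γ : ℝ} (hγ : AspectRatioLE E.region γ) {v : Plane → ℝ} (hv : v ∈ E.space)
    (i : Fin n) :
    |v (E.vert (finRotate n i)) - v (E.vert i)| ≤ 72 * √γ * seminormH1 E.region v ∧
    |v (midpoint ℝ (E.vert i) (E.vert (finRotate n i))) - v (E.vert i)| ≤
      72 * √γ * seminormH1 E.region v := by
  obtain ⟨z, hz, hD, hzD⟩ := E.exists_apex hγ i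
  obtain ⟨c₀, c₁, c₂, hq⟩ := E.exists_quadratic_on_edge hv i
  obtain ⟨h1, h2⟩ := (E.h1Regular_of_mem_space hv).increment_le_of_quadratic E.convex_region
    E.isCompact_region hz (E.vert_mem _) (E.vert_mem _) hD hq
  have hs := Real.sqrt_pos.2 hD
  have hsem : 0 ≤ seminormH1 E.region v := Real.sqrt_nonneg _
  have h3 := mul_le_mul_of_nonneg_right hzD hsem
  exact ⟨le_of_mul_le_mul_left (h1.trans (by linarith)) hs,
    le_of_mul_le_mul_left (h2.trans (by linarith)) hs⟩

/-- The oscillation of the nodal values, summed up along a chain of edges. -/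
theorem abs_node_sub_le {γ : ℝ} (hγ : AspectRatioLE E.region γ) {v : Plane → ℝ}
    (hv : v ∈ E.space) (i₀ : Fin n) (k : Fin n ⊕ Fin n) :
    |v (E.node k) - v (E.vert i₀)| ≤ (n + 1) * (72 * √γ * seminormH1 E.region v) := by
  set B := 72 * √γ * seminormH1 E.region v with hB
  have hB0 : 0 ≤ B := by unfold B seminormH1; positivity
  have hk : ∀ k : ℕ, |v (E.vert ((finRotate n)^[k] i₀)) - v (E.vert i₀)| ≤ k * B := by
    intro k
    induction k with
    | zero => simp
    | succ k ih =>
      rw [Function.iterate_succ_apply']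
      refine (abs_sub_le _ (v (E.vert ((finRotate n)^[k] i₀))) _).trans ?_
      have := (E.increment_le hγ hv ((finRotate n)^[k] i₀)).1
      push_cast
      linarith
  have hvert : ∀ i, |v (E.vert i) - v (E.vert i₀)| ≤ n * B := by
    intro i
    obtain ⟨k, hkn, rfl⟩ := ConvexPolygon.exists_iterate_finRotate i₀ i
    refine (hk k).trans ?_
    gcongr
  rcases k with i | i
  · refine (hvert i).trans ?_
    gcongr
    linarith
  · refine (abs_sub_le _ (v (E.vert i)) _).trans ?_
    have h1 := (E.increment_le hγ hv i).2
    have h2 := hvert i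
    simp only [ConvexPolygon.node, Sum.elim_inr]
    linarith

theorem abs_sub_vert_le {γ M : ℝ} (hγ : AspectRatioLE E.region γ)
    (hM : ∀ k a b, |E.coef k a b| ≤ M) {v : Plane → ℝ} (hv : v ∈ E.space) (i₀ : Fin n)
    {x : Plane} (hx : x ∈ E.region) :
    |v x - v (E.vert i₀)| ≤
      2 * n * ((n + 1) * (72 * √γ * seminormH1 E.region v)) * M := by
  have h1 : v x - v (E.vert i₀) =
      ∑ k, (v (E.node k) - v (E.vert i₀)) * shapeFun E.bary E.coef k x := by
    simp_rw [sub_mul]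
    rw [Finset.sum_sub_distrib, ← E.eq_sum_node hv hx,
      ← E.precision _ (const_mem_polyFun 2 (v (E.vert i₀))) x hx]
  rw [h1]
  refine (Finset.abs_sum_le_sum_abs _ _).trans ?_
  calc ∑ k, |(v (E.node k) - v (E.vert i₀)) * shapeFun E.bary E.coef k x|
      ≤ ∑ _k : Fin n ⊕ Fin n, ((n + 1) * (72 * √γ * seminormH1 E.region v)) * M := by
        gcongr with k
        rw [abs_mul]
        exact mul_le_mul (E.abs_node_sub_le hγ hv i₀ k) (E.abs_shapeFun_le hM k hx)
          (abs_nonneg _) (by unfold seminormH1; positivity)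
    _ = _ := by simp; ring

/-- The quadrature error on the element space. Since the quadrature is exact on constants, a nodal
value may be subtracted from `v`. -/
theorem quadrature_error_le {γ M W h : ℝ} (hγ : AspectRatioLE E.region γ)
    (hM : ∀ k a b, |E.coef k a b| ≤ M) (Q : QuadratureRule E.region)
    (hW : ∑ q, |Q.weight q| ≤ W * volume.real E.region) (hh : Metric.diam E.region ≤ h)
    (hQ : Q.ExactOn 0) {v : Plane → ℝ} (hv : v ∈ E.space) :
    |(∫ x in E.region, v x) - Q.apply v| ≤
      (1 + |W|) * Real.pi * (2 * n * ((n + 1) * (72 * √γ))) * M * h ^ 2 *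
        seminormH1 E.region v := by
  have hn := E.three_le
  let i₀ : Fin n := ⟨0, by omega⟩
  set m := v (E.vert i₀) with hm
  set s := 2 * n * ((n + 1) * (72 * √γ * seminormH1 E.region v)) * M with hs
  have hosc : ∀ x ∈ E.region, |v x - m| ≤ s := fun x hx => E.abs_sub_vert_le hγ hM hv i₀ hx
  have hs0 : 0 ≤ s := (abs_nonneg _).trans (hosc _ (E.vert_mem i₀))
  have hmeas : volume E.region < ⊤ := E.isCompact_region.measure_lt_top
  have hint := (E.h1Regular_of_mem_space hv).integrableOn E.isCompact_region
  have e0 := hQ _ (const_mem_polyFun 0 m)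
  have e1 : (∫ x in E.region, v x) - Q.apply v =
      (∫ x in E.region, (v x - m)) - Q.apply fun x => v x - m := by
    rw [integral_sub hint (integrableOn_const hmeas.ne), ← e0]
    simp only [QuadratureRule.apply, mul_sub, Finset.sum_sub_distrib]
    ring
  have b1 : |∫ x in E.region, (v x - m)| ≤ s * volume.real E.region := by
    rw [← Real.norm_eq_abs]
    exact norm_setIntegral_le_of_norm_le_const hmeas fun x hx => hosc x hx
  have b2 : |Q.apply fun x => v x - m| ≤ s * (|W| * volume.real E.region) := by
    calc |Q.apply fun x => v x - m| ≤ ∑ q, |Q.weight q * (v (Q.point q) - m)| :=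
          Finset.abs_sum_le_sum_abs _ _
      _ ≤ ∑ q, |Q.weight q| * s := by
          gcongr with q
          rw [abs_mul]
          exact mul_le_mul_of_nonneg_left (hosc _ (Q.point_mem q)) (abs_nonneg _)
      _ = s * ∑ q, |Q.weight q| := by rw [← Finset.sum_mul, mul_comm]
      _ ≤ s * (|W| * volume.real E.region) := by
          gcongr
          exact hW.trans (mul_le_mul_of_nonneg_right (le_abs_self W) measureReal_nonneg)
  rw [e1]
  calc _ ≤ s * volume.real E.region + s * (|W| * volume.real E.region) :=
        (abs_sub _ _).trans (add_le_add b1 b2)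
    _ = s * (1 + |W|) * volume.real E.region := by ring
    _ ≤ s * (1 + |W|) * (Real.pi * h ^ 2) := by
        gcongr
        exact E.volume_region_le hh
    _ = _ := by rw [hs]; ring

end QuadraticElement

/-! ### The energy form -/

theorem energyDensity_eq (S : Set Plane) (K : Matrix (Fin 2) (Fin 2) ℝ) (u v : Plane → ℝ)
    (x : Plane) : energyDensity S K u v x =
      ∑ i, ∑ j, K i j * (gradientWithin u S x i * gradientWithin v S x j) := by
  simp only [energyDensity, flux, dotProduct, mulVec, Fin.sum_univ_two]
  ring

theorem energyDensity_comm (S : Set Plane) {K : Matrix (Fin 2) (Fin 2) ℝ} (hK : K.PosDef)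
    (u v : Plane → ℝ) (x : Plane) : energyDensity S K u v x = energyDensity S K v u x := by
  have h : K 1 0 = K 0 1 := by simpa using hK.1.apply 0 1
  simp only [energyDensity_eq, Fin.sum_univ_two, h]
  ring

theorem energy_comm (S : Set Plane) {K : Matrix (Fin 2) (Fin 2) ℝ} (hK : K.PosDef)
    (u v : Plane → ℝ) : energy S K u v = energy S K v u := by
  simp only [energy, energyDensity_comm S hK u v]

theorem energy_congr_right {S : Set Plane} (hS : Convex ℝ S) (K : Matrix (Fin 2) (Fin 2) ℝ)
    (u : Plane → ℝ) {v w : Plane → ℝ} (h : EqOn v w S) : energy S K u v = energy S K u w := by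
  refine integral_congr_ae ?_
  filter_upwards [ae_mem_interior_of_convex hS] with x hx
  simp only [energyDensity_eq, gradientWithin_congr h (interior_subset hx)]

namespace H1Regular

variable {S : Set Plane} {u v w : Plane → ℝ}

theorem memLp_gradientWithin_apply (hu : H1Regular S u) (i : Fin 2) :
    MemLp (fun x => gradientWithin u S x i) 2 (volume.restrict S) :=
  (EuclideanSpace.proj (𝕜 := ℝ) i : Plane →L[ℝ] ℝ).comp_memLp' hu.memLp_gradientWithin

theorem integrableOn_energyDensity (hu : H1Regular S u) (hv : H1Regular S v)
    (K : Matrix (Fin 2) (Fin 2) ℝ) : IntegrableOn (energyDensity S K u v) S := by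
  have h : energyDensity S K u v = fun x =>
      ∑ i, ∑ j, K i j * (gradientWithin u S x i * gradientWithin v S x j) :=
    funext (energyDensity_eq S K u v)
  rw [h]
  refine integrable_finsetSum _ fun i _ => integrable_finsetSum _ fun j _ =>
    Integrable.const_mul ?_ _
  exact (hu.memLp_gradientWithin_apply i).integrable_mul (hv.memLp_gradientWithin_apply j)

theorem energy_add_right (hS : Convex ℝ S) (hu : H1Regular S u) (hv : H1Regular S v)
    (hw : H1Regular S w) (K : Matrix (Fin 2) (Fin 2) ℝ) :
    energy S K u (v + w) = energy S K u v + energy S K u w := by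
  unfold energy
  rw [← integral_add (hu.integrableOn_energyDensity hv K) (hu.integrableOn_energyDensity hw K)]
  refine integral_congr_ae ?_
  filter_upwards [gradientWithin_add hS hv hw] with x hx
  have hx' : gradientWithin (v + w) S x = gradientWithin v S x + gradientWithin w S x := hx
  simp only [energyDensity_eq, hx', PiLp.add_apply, ← Finset.sum_add_distrib]
  refine Finset.sum_congr rfl fun i _ => Finset.sum_congr rfl fun j _ => ?_
  ring

theorem energy_smul_right (hS : Convex ℝ S) (hv : H1Regular S v) (K : Matrix (Fin 2) (Fin 2) ℝ)
    (r : ℝ) : energy S K u (r • v) = r * energy S K u v := by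
  unfold energy
  rw [← integral_const_mul]
  refine integral_congr_ae ?_
  filter_upwards [hv.ae_differentiableAt hS] with x hx
  have hx' : gradientWithin (r • v) S x = r • gradientWithin v S x := by
    rw [gradientWithin_of_mem_interior hx.1, gradientWithin_of_mem_interior hx.1, gradient,
      gradient, fderiv_const_smul hx.2]
    simp
  simp only [energyDensity_eq, hx', PiLp.smul_apply, smul_eq_mul, Finset.mul_sum]
  refine Finset.sum_congr rfl fun i _ => Finset.sum_congr rfl fun j _ => ?_
  ring

end H1Regular

/-! ### Quadratic polynomials -/

theorem exists_coeff_of_mem_polyFun_two {p : Plane → ℝ} (hp : p ∈ polyFun 2) :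
    ∃ a₀ a₁ a₂ a₃ a₄ a₅ : ℝ, ∀ x : Plane,
      p x = a₀ + a₁ * x 0 + a₂ * x 1 + a₃ * x 0 ^ 2 + a₄ * (x 0 * x 1) + a₅ * x 1 ^ 2 := by
  obtain ⟨q, hq, hpq⟩ := mem_polyFun.1 hp
  let f : (Fin 2 →₀ ℕ) → Plane → ℝ := fun d x => q.coeff d * (x 0 ^ d 0 * x 1 ^ d 1)
  have h1 : ∀ s ⊆ q.support, ∃ a₀ a₁ a₂ a₃ a₄ a₅ : ℝ, ∀ x : Plane, ∑ d ∈ s, f d x =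
      a₀ + a₁ * x 0 + a₂ * x 1 + a₃ * x 0 ^ 2 + a₄ * (x 0 * x 1) + a₅ * x 1 ^ 2 := by
    classical
    intro s
    induction s using Finset.induction_on with
    | empty => exact fun _ => ⟨0, 0, 0, 0, 0, 0, fun x => by simp⟩
    | insert d s hd ih =>
      intro hs
      obtain ⟨a₀, a₁, a₂, a₃, a₄, a₅, h⟩ := ih ((Finset.subset_insert _ _).trans hs)
      have h2 : d 0 + d 1 ≤ 2 := by
        have := (MvPolynomial.le_totalDegree (hs (Finset.mem_insert_self d s))).trans hq
        rwa [Finsupp.sum_fintype _ _ (fun _ => rfl), Fin.sum_univ_two] at this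
      set c := q.coeff d with hc
      have h3 : (d 0 = 0 ∧ d 1 = 0) ∨ (d 0 = 1 ∧ d 1 = 0) ∨ (d 0 = 0 ∧ d 1 = 1) ∨
          (d 0 = 2 ∧ d 1 = 0) ∨ (d 0 = 1 ∧ d 1 = 1) ∨ (d 0 = 0 ∧ d 1 = 2) := by omega
      rcases h3 with h3 | h3 | h3 | h3 | h3 | h3
      · refine ⟨c + a₀, a₁, a₂, a₃, a₄, a₅, fun x => ?_⟩
        rw [Finset.sum_insert hd, h]; simp only [f, h3]; ring
      · refine ⟨a₀, c + a₁, a₂, a₃, a₄, a₅, fun x => ?_⟩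
        rw [Finset.sum_insert hd, h]; simp only [f, h3]; ring
      · refine ⟨a₀, a₁, c + a₂, a₃, a₄, a₅, fun x => ?_⟩
        rw [Finset.sum_insert hd, h]; simp only [f, h3]; ring
      · refine ⟨a₀, a₁, a₂, c + a₃, a₄, a₅, fun x => ?_⟩
        rw [Finset.sum_insert hd, h]; simp only [f, h3]; ring
      · refine ⟨a₀, a₁, a₂, a₃, c + a₄, a₅, fun x => ?_⟩
        rw [Finset.sum_insert hd, h]; simp only [f, h3]; ring
      · refine ⟨a₀, a₁, a₂, a₃, a₄, c + a₅, fun x => ?_⟩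
        rw [Finset.sum_insert hd, h]; simp only [f, h3]; ring
  obtain ⟨a₀, a₁, a₂, a₃, a₄, a₅, h⟩ := h1 _ subset_rfl
  refine ⟨a₀, a₁, a₂, a₃, a₄, a₅, fun x => ?_⟩
  rw [hpq, ← h, MvPolynomial.eval_eq']
  simp [f, Fin.prod_univ_two]

theorem hasFDerivAt_coord (i : Fin 2) (x : Plane) :
    HasFDerivAt (fun y : Plane => y i) (EuclideanSpace.proj (𝕜 := ℝ) i : Plane →L[ℝ] ℝ) x :=
  (EuclideanSpace.proj (𝕜 := ℝ) i : Plane →L[ℝ] ℝ).hasFDerivAt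

theorem hasGradientAt_quadratic {p : Plane → ℝ} {a₀ a₁ a₂ a₃ a₄ a₅ : ℝ}
    (hp : ∀ x : Plane,
      p x = a₀ + a₁ * x 0 + a₂ * x 1 + a₃ * x 0 ^ 2 + a₄ * (x 0 * x 1) + a₅ * x 1 ^ 2)
    (x : Plane) :
    HasGradientAt p !₂[a₁ + 2 * a₃ * x 0 + a₄ * x 1, a₂ + a₄ * x 0 + 2 * a₅ * x 1] x := by
  rw [hasGradientAt_iff_hasFDerivAt]
  have h0 := hasFDerivAt_coord 0 x
  have h1 := hasFDerivAt_coord 1 x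
  have h := (((((hasFDerivAt_const a₀ x).fun_add (h0.const_mul a₁)).fun_add
    (h1.const_mul a₂)).fun_add ((h0.fun_mul h0).const_mul a₃)).fun_add
    ((h0.fun_mul h1).const_mul a₄)).fun_add ((h1.fun_mul h1).const_mul a₅)
  simp only [← pow_two] at h
  rw [funext hp]
  refine h.congr_fderiv ?_
  ext y
  simp [PiLp.inner_apply, Fin.sum_univ_two]
  ring

theorem contDiff_of_mem_polyFun_two {p : Plane → ℝ} (hp : p ∈ polyFun 2) : ContDiff ℝ 1 p := by
  obtain ⟨a₀, a₁, a₂, a₃, a₄, a₅, h⟩ := exists_coeff_of_mem_polyFun_two hp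
  rw [funext h]
  fun_prop

/-- The constant value of `div (K ∇p)` for a quadratic `p`, written by second differences so that
it is evidently linear in `p`. -/
def divFlux (K : Matrix (Fin 2) (Fin 2) ℝ) (p : Plane → ℝ) : ℝ :=
  K 0 0 * (p !₂[1, 0] + p !₂[-1, 0] - 2 * p !₂[0, 0]) +
    (K 0 1 + K 1 0) * (p !₂[1, 1] - p !₂[1, 0] - p !₂[0, 1] + p !₂[0, 0]) +
    K 1 1 * (p !₂[0, 1] + p !₂[0, -1] - 2 * p !₂[0, 0])

/-- For a quadratic polynomial the flux is, on `S`, an affine field whose divergence is the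
constant `divFlux K p`. -/
theorem exists_flux_eq {S : Set Plane} (hS : Convex ℝ S) (hne : (interior S).Nonempty)
    (K : Matrix (Fin 2) (Fin 2) ℝ) {p : Plane → ℝ} (hp : p ∈ polyFun 2) :
    ∃ G : Fin 2 → Plane → ℝ, (∀ i, ContDiff ℝ 1 (G i)) ∧
      (∀ x ∈ S, ∀ i, flux S K p x i = G i x) ∧
      ∀ x, ∑ i, fderiv ℝ (G i) x (EuclideanSpace.single i 1) = divFlux K p := by
  obtain ⟨a₀, a₁, a₂, a₃, a₄, a₅, h⟩ := exists_coeff_of_mem_polyFun_two hp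
  have hu := uniqueDiffOn_convex hS hne
  refine ⟨fun i x => K i 0 * (a₁ + 2 * a₃ * x 0 + a₄ * x 1) +
    K i 1 * (a₂ + a₄ * x 0 + 2 * a₅ * x 1), fun i => by fun_prop, fun x hx i => ?_, fun x => ?_⟩
  · have h1 := hasGradientAt_quadratic h x
    have h2 : gradientWithin p S x = gradient p x := by
      rw [gradientWithin, gradient, h1.differentiableAt.fderivWithin (hu x hx)]
    rw [flux, h2, h1.gradient]
    simp [mulVec, dotProduct, Fin.sum_univ_two]
  · have h0 := hasFDerivAt_coord 0 x
    have h1 := hasFDerivAt_coord 1 x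
    have hG : ∀ i, HasFDerivAt (fun x : Plane => K i 0 * (a₁ + 2 * a₃ * x 0 + a₄ * x 1) +
        K i 1 * (a₂ + a₄ * x 0 + 2 * a₅ * x 1)) _ x := fun i =>
      (((((hasFDerivAt_const a₁ x).fun_add (h0.const_mul (2 * a₃))).fun_add
        (h1.const_mul a₄)).const_mul (K i 0))).fun_add
      (((((hasFDerivAt_const a₂ x).fun_add (h0.const_mul a₄)).fun_add
        (h1.const_mul (2 * a₅))).const_mul (K i 1)))
    rw [Fin.sum_univ_two, (hG 0).fderiv, (hG 1).fderiv]
    simp only [divFlux, h]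
    simp
    ring

theorem divergence_flux {S : Set Plane} (hS : Convex ℝ S) (hne : (interior S).Nonempty)
    (K : Matrix (Fin 2) (Fin 2) ℝ) {p : Plane → ℝ} (hp : p ∈ polyFun 2) {x : Plane}
    (hx : x ∈ S) : divergence S (flux S K p) x = divFlux K p := by
  obtain ⟨G, hG, hfG, hdiv⟩ := exists_flux_eq hS hne K hp
  rw [divergence, ← hdiv x]
  refine Finset.sum_congr rfl fun i _ => ?_
  rw [fderivWithin_congr (fun y hy => hfG y hy i) (hfG x hx i),
    ((hG i).differentiable one_ne_zero x).fderivWithin (uniqueDiffOn_convex hS hne x hx)]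

/-- Green's formula for a quadratic polynomial and a function of low regularity. -/
theorem ConvexPolygon.energy_eq {n : ℕ} (T : ConvexPolygon n)
    (hne : (interior T.region).Nonempty) {K : Matrix (Fin 2) (Fin 2) ℝ} (hK : K.PosDef)
    {p v : Plane → ℝ} (hp : p ∈ polyFun 2) (hv : H1Regular T.region v) :
    energy T.region K p v = -(divFlux K p * ∫ x in T.region, v x) +
      T.boundaryIntegral v (flux T.region K p) := by
  have hS := T.convex_region
  have hc := T.isCompact_region
  obtain ⟨G, hG, hfG, hdiv⟩ := exists_flux_eq hS hne K hp
  have hGr : ∀ i, H1Regular T.region (G i) := fun i => H1Regular.of_contDiff hS hc (hG i)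
  have hvG : ∀ i, H1Regular T.region fun x => v x * G i x := fun i => hv.mul hS hc (hGr i)
  have key := fun i : Fin 2 =>
    T.integral_inner_gradientWithin (hvG i) hne (EuclideanSpace.single i 1)
  have hcross : ∀ (i : Fin 2) (j : Fin n),
      cross (EuclideanSpace.single i 1) (T.edge j) = T.edgeNormal j i := by
    intro i j
    fin_cases i <;> simp [cross, ConvexPolygon.edge, ConvexPolygon.edgeNormal]
  -- the volume term
  have e1 : ∑ i : Fin 2, ∫ x in T.region, inner ℝ
      (gradientWithin (fun x => v x * G i x) T.region x) (EuclideanSpace.single i 1) =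
      energy T.region K p v + divFlux K p * ∫ x in T.region, v x := by
    have i1 : IntegrableOn (fun x => divFlux K p * v x) T.region :=
      (hv.integrableOn hc).const_mul _
    have hpr := H1Regular.of_contDiff hS hc (contDiff_of_mem_polyFun_two hp)
    rw [← integral_finsetSum _ fun i _ => (hvG i).integrableOn_inner hc _, energy,
      ← integral_const_mul, ← integral_add (hpr.integrableOn_energyDensity hv K) i1]
    refine integral_congr_ae ?_
    filter_upwards [hv.gradientWithin_mul hS (hGr 0), hv.gradientWithin_mul hS (hGr 1),
      ae_mem_interior_of_convex hS] with x h0 h1 hx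
    have hxS := interior_subset hx
    rw [energyDensity_comm _ hK, energyDensity, ← hdiv x, Fin.sum_univ_two, Fin.sum_univ_two, h0,
      h1, dotProduct, Fin.sum_univ_two, hfG x hxS, hfG x hxS,
      ← inner_gradient_left, ← inner_gradient_left, gradientWithin_of_mem_interior hx (G 0),
      gradientWithin_of_mem_interior hx (G 1)]
    simp only [EuclideanSpace.inner_single_right, one_mul, conj_trivial, PiLp.add_apply,
      PiLp.smul_apply, smul_eq_mul]
    ring
  -- the boundary term
  have e2 : ∑ i : Fin 2, ∑ j, cross (EuclideanSpace.single i 1) (T.edge j) *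
      segMean (fun x => v x * G i x) (T.vert j) (T.vert (finRotate n j)) =
      T.boundaryIntegral v (flux T.region K p) := by
    rw [Finset.sum_comm, boundaryIntegral]
    refine Finset.sum_congr rfl fun j _ => ?_
    simp only [hcross, segMean]
    simp_rw [← intervalIntegral.integral_const_mul]
    have hmem : ∀ t ∈ Icc (0 : ℝ) 1,
        AffineMap.lineMap (T.vert j) (T.vert (finRotate n j)) t ∈ T.region := fun t ht =>
      hS.lineMap_mem (T.vert_mem _) (T.vert_mem _) ht
    rw [← intervalIntegral.integral_finsetSum]
    · refine intervalIntegral.integral_congr fun t ht => ?_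
      rw [uIcc_of_le zero_le_one] at ht
      simp only [dotProduct, hfG _ (hmem t ht), Fin.sum_univ_two]
      ring
    · intro i _
      refine ContinuousOn.intervalIntegrable (continuousOn_const.mul ?_)
      refine (hvG i).continuousOn.comp AffineMap.lineMap_continuous.continuousOn fun t ht => ?_
      rw [uIcc_of_le zero_le_one] at ht
      exact hmem t ht
  have e3 := Finset.sum_congr rfl fun i (_ : i ∈ (Finset.univ : Finset (Fin 2))) => key i
  rw [e1, e2] at e3
  linarith

/-! ### The modified projection and consistency -/

theorem divFlux_add (K : Matrix (Fin 2) (Fin 2) ℝ) (p q : Plane → ℝ) :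
    divFlux K (p + q) = divFlux K p + divFlux K q := by
  simp only [divFlux, Pi.add_apply]; ring

theorem divFlux_smul (K : Matrix (Fin 2) (Fin 2) ℝ) (r : ℝ) (p : Plane → ℝ) :
    divFlux K (r • p) = r * divFlux K p := by
  simp only [divFlux, Pi.smul_apply, smul_eq_mul]; ring

theorem energy_const_left (S : Set Plane) (K : Matrix (Fin 2) (Fin 2) ℝ) (r : ℝ) (v : Plane → ℝ) :
    energy S K (fun _ => r) v = 0 := by
  simp [energy, energyDensity_eq, gradientWithin]

/-- The energy form is definite on quadratics modulo constants. -/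
theorem eq_zero_of_energy_self_eq_zero {S : Set Plane} (hS : Convex ℝ S) (hc : IsCompact S)
    (hne : (interior S).Nonempty) {K : Matrix (Fin 2) (Fin 2) ℝ} (hK : K.PosDef)
    {p : Plane → ℝ} (hp : p ∈ polyFun 2) (h : energy S K p p = 0) {y : Plane} (hy : p y = 0) :
    p = 0 := by
  obtain ⟨a₀, a₁, a₂, a₃, a₄, a₅, hpa⟩ := exists_coeff_of_mem_polyFun_two hp
  have hpr := H1Regular.of_contDiff hS hc (contDiff_of_mem_polyFun_two hp)
  have hpos : ∀ g : Plane, g ≠ 0 → 0 < g.ofLp ⬝ᵥ K *ᵥ g.ofLp := fun g hg => by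
    have := hK.dotProduct_mulVec_pos (x := g.ofLp) (by simpa using hg)
    simpa using this
  have h1 := (setIntegral_eq_zero_iff_of_nonneg_ae (Filter.Eventually.of_forall fun x => ?_)
    (hpr.integrableOn_energyDensity hpr K)).1 h
  swap
  · by_cases hg : gradientWithin p S x = 0
    · simp [energyDensity, hg]
    · exact (hpos _ hg).le
  let g : Plane → Plane :=
    fun x => !₂[a₁ + 2 * a₃ * x 0 + a₄ * x 1, a₂ + a₄ * x 0 + 2 * a₅ * x 1]
  have h2 : g =ᵐ[volume.restrict (interior S)] fun _ => 0 := by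
    filter_upwards [ae_restrict_of_ae_restrict_of_subset interior_subset h1,
      ae_restrict_mem isOpen_interior.measurableSet] with x hx hxi
    have hgx : gradientWithin p S x = g x := by
      rw [gradientWithin_of_mem_interior hxi, (hasGradientAt_quadratic hpa x).gradient]
    by_contra hg
    have := hpos _ hg
    rw [← hgx] at this
    exact this.ne' hx
  have hgc : Continuous g := by
    refine (PiLp.continuous_toLp 2 _).comp (continuous_pi fun i => ?_)
    fin_cases i <;> simp <;> fun_prop
  have h3 := Measure.eqOn_open_of_ae_eq h2 isOpen_interior hgc.continuousOn continuousOn_const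
  obtain ⟨z, hz⟩ := hne
  rw [← interior_interior] at hz
  obtain ⟨s, hs, hzs⟩ := exists_add_smul_mem hz (EuclideanSpace.single 0 1)
  obtain ⟨t, ht, hzt⟩ := exists_add_smul_mem hz (EuclideanSpace.single 1 1)
  have c1 := h3 (interior_subset hz)
  have c2 := h3 hzs
  have c3 := h3 hzt
  have d1 := congrArg (fun w : Plane => w 0) c1
  have d2 := congrArg (fun w : Plane => w 1) c1
  have d3 := congrArg (fun w : Plane => w 0) c2
  have d4 := congrArg (fun w : Plane => w 0) c3
  have d5 := congrArg (fun w : Plane => w 1) c3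
  simp [g] at d1 d2 d3 d4 d5
  have f3 : a₃ = 0 := (mul_eq_zero.1 (by linarith : a₃ * s = 0)).resolve_right hs.ne'
  have f4 : a₄ = 0 := (mul_eq_zero.1 (by linarith : a₄ * t = 0)).resolve_right ht.ne'
  have f5 : a₅ = 0 := (mul_eq_zero.1 (by linarith : a₅ * t = 0)).resolve_right ht.ne'
  rw [f3, f4] at d1
  rw [f4, f5] at d2
  have f1 : a₁ = 0 := by linarith
  have f2 : a₂ = 0 := by linarith
  rw [f1, f2, f3, f4, f5] at hpa
  funext x
  rw [hpa] at hy
  simp only [hpa, Pi.zero_apply]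
  linarith

namespace QuadraticElement

variable {n : ℕ} (E : QuadraticElement n)

theorem h1Regular_of_mem_polyFun_two {p : Plane → ℝ} (hp : p ∈ polyFun 2) :
    H1Regular E.region p :=
  E.h1Regular_of_mem_space (E.polyFun_le_space hp)

theorem energy_add_left (K : Matrix (Fin 2) (Fin 2) ℝ) (hK : K.PosDef) {u v w : Plane → ℝ}
    (hu : H1Regular E.region u) (hv : H1Regular E.region v) (hw : H1Regular E.region w) :
    energy E.region K (u + v) w = energy E.region K u w + energy E.region K v w := by
  rw [energy_comm _ hK, hw.energy_add_right E.convex_region hu hv K, energy_comm _ hK w u,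
    energy_comm _ hK w v]

theorem energy_smul_left (K : Matrix (Fin 2) (Fin 2) ℝ) (hK : K.PosDef) {u w : Plane → ℝ}
    (hu : H1Regular E.region u) (r : ℝ) :
    energy E.region K (r • u) w = r * energy E.region K u w := by
  rw [energy_comm _ hK, hu.energy_smul_right E.convex_region K r, energy_comm _ hK w u]

/-- The inner product `a(p, q) + p(y) q(y)` on quadratics. -/
def pointedEnergy (K : Matrix (Fin 2) (Fin 2) ℝ) (hK : K.PosDef) (y : Plane) :
    polyFun 2 →ₗ[ℝ] Module.Dual ℝ (polyFun 2) :=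
  LinearMap.mk₂ ℝ (fun q p => energy E.region K p q + (p : Plane → ℝ) y * (q : Plane → ℝ) y)
    (fun q q' p => by
      have := (E.h1Regular_of_mem_polyFun_two p.2).energy_add_right E.convex_region
        (E.h1Regular_of_mem_polyFun_two q.2) (E.h1Regular_of_mem_polyFun_two q'.2) K
      simp only [Submodule.coe_add, this, Pi.add_apply]; ring)
    (fun r q p => by
      have := (E.h1Regular_of_mem_polyFun_two q.2).energy_smul_right (u := p) E.convex_region K r
      simp only [Submodule.coe_smul, this, Pi.smul_apply, smul_eq_mul]; ring)
    (fun q p p' => by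
      have := E.energy_add_left K hK (E.h1Regular_of_mem_polyFun_two p.2)
        (E.h1Regular_of_mem_polyFun_two p'.2) (E.h1Regular_of_mem_polyFun_two q.2)
      simp only [Submodule.coe_add, this, Pi.add_apply]; ring)
    (fun r q p => by
      have := E.energy_smul_left K hK (w := q) (E.h1Regular_of_mem_polyFun_two p.2) r
      simp only [Submodule.coe_smul, this, Pi.smul_apply, smul_eq_mul]; ring)

/-- The functional `p ↦ a(p, v) + div(K∇p) (∫ v - ⨍ v) + p(y) v(y)`, which by Green's formula is
the right-hand side defining the modified projection of `v`, completed by the point value. -/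
def pointedLoad (K : Matrix (Fin 2) (Fin 2) ℝ) (hK : K.PosDef) (Q : QuadratureRule E.region)
    (y : E.region) : E.space →ₗ[ℝ] Module.Dual ℝ (polyFun 2) :=
  LinearMap.mk₂ ℝ (fun v p => energy E.region K p v +
      divFlux K p * ((∫ x in E.region, (v : Plane → ℝ) x) - Q.apply v) +
      (p : Plane → ℝ) y * (v : Plane → ℝ) y)
    (fun v v' p => by
      have hv := E.h1Regular_of_mem_space v.2
      have hv' := E.h1Regular_of_mem_space v'.2
      have h1 := (E.h1Regular_of_mem_polyFun_two p.2).energy_add_right E.convex_region hv hv' K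
      have h2 : ∫ x in E.region, ((v : Plane → ℝ) + (v' : Plane → ℝ)) x =
          (∫ x in E.region, (v : Plane → ℝ) x) + ∫ x in E.region, (v' : Plane → ℝ) x :=
        integral_add (hv.integrableOn E.isCompact_region) (hv'.integrableOn E.isCompact_region)
      have h3 : Q.apply ((v : Plane → ℝ) + (v' : Plane → ℝ)) = Q.apply v + Q.apply v' := by
        simp [QuadratureRule.apply, mul_add, Finset.sum_add_distrib]
      simp only [Submodule.coe_add, h1, h2, h3]
      simp only [Pi.add_apply]; ring)
    (fun r v p => by
      have hv := E.h1Regular_of_mem_space v.2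
      have h1 := hv.energy_smul_right (u := p) E.convex_region K r
      have h2 : ∫ x in E.region, (r • (v : Plane → ℝ)) x =
          r * ∫ x in E.region, (v : Plane → ℝ) x := integral_const_mul r _
      have h3 : Q.apply (r • (v : Plane → ℝ)) = r * Q.apply v := by
        simp only [QuadratureRule.apply, Pi.smul_apply, smul_eq_mul, Finset.mul_sum]
        exact Finset.sum_congr rfl fun q _ => by ring
      simp only [Submodule.coe_smul, h1, h2, h3]
      simp only [Pi.smul_apply, smul_eq_mul]; ring)
    (fun v p p' => by
      have h1 := E.energy_add_left K hK (E.h1Regular_of_mem_polyFun_two p.2)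
        (E.h1Regular_of_mem_polyFun_two p'.2) (E.h1Regular_of_mem_space v.2)
      simp only [Submodule.coe_add, h1, divFlux_add, Pi.add_apply]; ring)
    (fun r v p => by
      have h1 := E.energy_smul_left K hK (w := v) (E.h1Regular_of_mem_polyFun_two p.2) r
      simp only [Submodule.coe_smul, h1, divFlux_smul, Pi.smul_apply, smul_eq_mul]; ring)

theorem injective_pointedEnergy (hne : (interior E.region).Nonempty)
    (K : Matrix (Fin 2) (Fin 2) ℝ) (hK : K.PosDef) (y : Plane) :
    Function.Injective (E.pointedEnergy K hK y) := by
  rw [injective_iff_map_eq_zero]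
  intro p hp
  have h1 : energy E.region K p p + (p : Plane → ℝ) y * (p : Plane → ℝ) y = 0 :=
    LinearMap.congr_fun hp p
  have h2 : 0 ≤ energy E.region K p p := integral_nonneg fun x => by
    by_cases hg : gradientWithin (p : Plane → ℝ) E.region x = 0
    · simp [energyDensity, hg]
    · have := hK.dotProduct_mulVec_pos
        (x := (gradientWithin (p : Plane → ℝ) E.region x).ofLp) (by simpa using hg)
      simpa [energyDensity, flux] using this.le
  have h3 := mul_self_nonneg ((p : Plane → ℝ) y)
  exact Subtype.ext (eq_zero_of_energy_self_eq_zero E.convex_region E.isCompact_region hne hK p.2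
    (by linarith) (mul_self_eq_zero.1 (by linarith)))

theorem apply_mul_divergence (hne : (interior E.region).Nonempty) (K : Matrix (Fin 2) (Fin 2) ℝ)
    (Q : QuadratureRule E.region) {p : Plane → ℝ} (hp : p ∈ polyFun 2) (v : Plane → ℝ) :
    Q.apply (fun x => v x * divergence E.region (flux E.region K p) x) =
      divFlux K p * Q.apply v := by
  simp only [QuadratureRule.apply, Finset.mul_sum]
  refine Finset.sum_congr rfl fun q _ => ?_
  rw [divergence_flux E.convex_region hne K hp (Q.point_mem q)]
  ring

/-- The modified projection exists: the energy form together with the value at a point of the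
polygon is an inner product on quadratics, and the load functional is represented by it. Exactness
on quadratics makes the load of a quadratic `q` the functional represented by `q`. -/
theorem exists_isModifiedProjection (hne : (interior E.region).Nonempty)
    (K : Matrix (Fin 2) (Fin 2) ℝ) (hK : K.PosDef) (Q : QuadratureRule E.region)
    (hQ : Q.ExactOn 2) : ∃ P : E.space →ₗ[ℝ] polyFun 2, E.IsModifiedProjection K Q P := by
  have hfin : Module.Finite ℝ (polyFun 2) := by unfold polyFun; infer_instance
  obtain ⟨y, hy⟩ := hne.mono interior_subset
  let Φ : polyFun 2 ≃ₗ[ℝ] Module.Dual ℝ (polyFun 2) :=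
    LinearMap.linearEquivOfInjective (E.pointedEnergy K hK y) (E.injective_pointedEnergy hne K hK y)
      Subspace.dual_finrank_eq.symm
  have hΦ : ∀ q, Φ q = E.pointedEnergy K hK y q := fun q => rfl
  let P : E.space →ₗ[ℝ] polyFun 2 := Φ.symm.toLinearMap ∘ₗ E.pointedLoad K hK Q ⟨y, hy⟩
  have hP : ∀ v, E.pointedEnergy K hK y (P v) = E.pointedLoad K hK Q ⟨y, hy⟩ v := fun v => by
    rw [← hΦ]; exact Φ.apply_symm_apply _
  refine ⟨P, fun p hp v => ?_, fun p v hpv => ?_⟩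
  · have h1 : ∀ q : polyFun 2, energy E.region K q (P v : Plane → ℝ) +
        (q : Plane → ℝ) y * (P v : Plane → ℝ) y = energy E.region K q v +
          divFlux K q * ((∫ x in E.region, (v : Plane → ℝ) x) - Q.apply v) +
          (q : Plane → ℝ) y * (v : Plane → ℝ) y := fun q => LinearMap.congr_fun (hP v) q
    -- testing with constants identifies the value at `y`
    have h2 : (P v : Plane → ℝ) y = (v : Plane → ℝ) y := by
      have := h1 ⟨fun _ => 1, const_mem_polyFun 2 1⟩
      simp only [energy_const_left] at this
      have hd : divFlux K (fun _ => 1) = 0 := by simp only [divFlux]; ring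
      rw [hd] at this
      linarith
    have h3 := h1 ⟨p, hp⟩
    simp only [h2] at h3
    rw [E.apply_mul_divergence hne K Q hp]
    have h4 := E.energy_eq hne hK hp (E.h1Regular_of_mem_space v.2)
    linarith
  · refine E.injective_pointedEnergy hne K hK y ?_
    rw [hP]
    ext q
    change energy E.region K q v + divFlux K q *
      ((∫ x in E.region, (v : Plane → ℝ) x) - Q.apply v) + (q : Plane → ℝ) y * (v : Plane → ℝ) y =
      energy E.region K q p + (q : Plane → ℝ) y * (p : Plane → ℝ) y
    have h1 : ∫ x in E.region, (v : Plane → ℝ) x = Q.apply v := by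
      rw [setIntegral_congr_fun E.isCompact_region.isClosed.measurableSet hpv, ← hQ p p.2]
      exact Finset.sum_congr rfl fun i _ => by rw [hpv (Q.point_mem i)]
    rw [energy_congr_right E.convex_region K q hpv, h1, hpv hy]
    ring

/-- The consistency error is the quadrature error of `v`, multiplied by `div(K∇p)`: the stabilizing
term vanishes because the projection fixes `p`, and Green's formula holds without quadrature. -/
theorem discreteEnergy_sub_energy (hne : (interior E.region).Nonempty)
    {K : Matrix (Fin 2) (Fin 2) ℝ} (hK : K.PosDef) {Q : QuadratureRule E.region}
    {P : E.space →ₗ[ℝ] polyFun 2} (hP : E.IsModifiedProjection K Q P)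
    {p : Plane → ℝ} (hp : p ∈ polyFun 2) (v : E.space) :
    E.discreteEnergy K Q P ⟨p, E.polyFun_le_space hp⟩ v - energy E.region K p v =
      divFlux K p * ((∫ x in E.region, (v : Plane → ℝ) x) - Q.apply v) := by
  have h1 : P ⟨p, E.polyFun_le_space hp⟩ = ⟨p, hp⟩ := hP.fixes ⟨p, hp⟩ _ fun x _ => rfl
  have h2 : ∀ w, energyDensity E.region K (p - p) w = fun _ => 0 := fun w => by
    funext x
    have h0 : gradientWithin (0 : Plane → ℝ) E.region x = 0 := by simp [gradientWithin]
    rw [sub_self]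
    simp [energyDensity, h0]
  rw [discreteEnergy, h1]
  simp only [h2]
  rw [hP.energy_eq p hp v, E.apply_mul_divergence hne K Q hp,
    E.energy_eq hne hK hp (E.h1Regular_of_mem_space v.2)]
  simp only [QuadratureRule.apply, mul_zero, Finset.sum_const_zero]
  ring

end QuadraticElement

end PolyFE

end

theorem mainTheorem5 (γ M W : ℝ) (N : ℕ) :
    ∃ C : ℝ, 0 < C ∧
      ∀ (n : ℕ) (E : PolyFE.QuadraticElement n) (Q : PolyFE.QuadratureRule E.region) (h : ℝ),
        n ≤ N →
        PolyFE.AspectRatioLE E.region γ →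
        (∀ i a b, |E.coef i a b| ≤ M) →
        ∑ q, |Q.weight q| ≤ W * volume.real E.region →
        Metric.diam E.region ≤ h →
        Q.ExactOn 0 →
        -- the quadrature error on the element space
        (∀ v ∈ E.space,
          |(∫ x in E.region, v x) - Q.apply v| ≤
            C * h ^ 2 * PolyFE.seminormH1 E.region v) ∧
        ∀ K : Matrix (Fin 2) (Fin 2) ℝ, K.PosDef →
          -- the modified projection exists when the quadrature is exact on quadratics
          (Q.ExactOn 2 →
            ∃ P : E.space →ₗ[ℝ] PolyFE.polyFun 2, E.IsModifiedProjection K Q P) ∧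
          -- consistency identity and weak consistency
          ∀ P : E.space →ₗ[ℝ] PolyFE.polyFun 2, E.IsModifiedProjection K Q P →
            ∀ (p : PolyFE.Plane → ℝ) (hp : p ∈ PolyFE.polyFun 2) (v : E.space),
              ∃ c : ℝ,
                (∀ x ∈ E.region,
                  PolyFE.divergence E.region (PolyFE.flux E.region K p) x = c) ∧
                |E.discreteEnergy K Q P ⟨p, E.polyFun_le_space hp⟩ v
                    - PolyFE.energy E.region K p v| =
                  |c| * |(∫ x in E.region, (v : PolyFE.Plane → ℝ) x) - Q.apply v| ∧
                |E.discreteEnergy K Q P ⟨p, E.polyFun_le_space hp⟩ v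
                    - PolyFE.energy E.region K p v| ≤
                  C * |c| * h ^ 2 * PolyFE.seminormH1 E.region v := by
  -- the constant of `quadrature_error_le` for the largest number of vertices, made positive
  set C : ℝ := (1 + |W|) * Real.pi * (2 * N * ((N + 1) * (72 * √γ))) * |M| + 1 with hC
  refine ⟨C, by positivity, fun n E Q h hn hγ hM hW hh hQ => ?_⟩
  have hne : (interior E.region).Nonempty := by
    obtain ⟨z, r, hr, hball, -⟩ := hγ
    exact ⟨z, mem_interior_iff_mem_nhds.2
      (Filter.mem_of_superset (Metric.closedBall_mem_nhds z hr) hball)⟩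
  have part1 : ∀ v ∈ E.space, |(∫ x in E.region, v x) - Q.apply v| ≤
      C * h ^ 2 * PolyFE.seminormH1 E.region v := fun v hv => by
    refine (E.quadrature_error_le hγ hM Q hW hh hQ hv).trans ?_
    have hsem : 0 ≤ PolyFE.seminormH1 E.region v := Real.sqrt_nonneg _
    have hnN : (n : ℝ) ≤ N := by exact_mod_cast hn
    refine mul_le_mul_of_nonneg_right (mul_le_mul_of_nonneg_right ?_ (sq_nonneg h)) hsem
    calc _ ≤ (1 + |W|) * Real.pi * (2 * n * ((n + 1) * (72 * √γ))) * |M| := by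
          gcongr
          exact le_abs_self M
      _ ≤ (1 + |W|) * Real.pi * (2 * N * ((N + 1) * (72 * √γ))) * |M| := by gcongr
      _ ≤ C := by rw [hC]; linarith
  refine ⟨part1, fun K hK => ⟨E.exists_isModifiedProjection hne K hK Q, fun P hP p hp v =>
    ⟨PolyFE.divFlux K p, fun x hx => PolyFE.divergence_flux E.convex_region hne K hp hx, ?_, ?_⟩⟩⟩
  · rw [E.discreteEnergy_sub_energy hne hK hP hp v, abs_mul]
  · rw [E.discreteEnergy_sub_energy hne hK hP hp v, abs_mul]
    calc _ ≤ |PolyFE.divFlux K p| * (C * h ^ 2 * PolyFE.seminormH1 E.region v) :=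
          mul_le_mul_of_nonneg_left (part1 v v.2) (abs_nonneg _)
      _ = _ := by ring
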